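/- **Proposition 2.** Let $\rho$ be a density matrix of one qubit, diagonalized by a unitary $U_\rho$: $U_\rho\,\rho\,U_\rho^\dagger=(1-p)|0\rangle\langle 0|+p|1\rangle\langle 1|$ with $p\in[0,1]$. Let $H=-\operatorname{Tr}(\rho\log_2\rho)=h(p)$ be its entropy in bits, let $\delta>0$, and for $\nu\in\mathbb N$ put $N=2^\nu$ and $K=\max\{0,\lfloor(1-H-\delta)N\rfloor\}$. *Polar code.* Let $G_1=(1)$, $G_2=\begin{pmatrix}1&0\\1&1\end{pmatrix}$ and $G_N=(I_{N/2}\otimes G_2)R_N(I_2\otimes G_{N/2})$ over $\mathbb F_2$, where $R_N$ is the permutation matrix with $(s_1,\dots,s_N)R_N=(s_1,s_3,\dots,s_{N-1},s_2,s_4,\dots,s_N)$. Let $W$ be the binary symmetric channel with error probability $p$; the $i$-th effective channel has input $u_i$, output $(y,u_1^{i-1})$ and transition probabilities $$W_N^{(i)}(y,u_1^{i-1}\mid u_i)=2^{-(N-1)}\sum_{u_{i+1}^N}\prod_{j=1}^N W\big(y_j\mid (uG_N)_j\big).$$ Let the information set $\mathcal I\subseteq\{1,\dots,N\}$ consist of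 $K$ indices whose effective channels have the largest capacity (mutual information between a uniform input and the output), with ties broken arbitrarily. The $N-K$ indices in $\mathcal I^c$ are frozen. *Syndrome decoder.* Let $X\in\mathbb F_2^N$ have independent bits that equal $1$ with probability $p$, and let $U$ be given by $UG_N=X$. The polar syndrome (successive cancellation) decoder $f:\mathbb F_2^{\mathcal I^c}\to\mathbb F_2^N$ maps a syndrome $s$ to $f(s)=\hat uG_N$, where for $i=1,\dots,N$ in turn $\hat u_i=s_i$ if $i\in\mathcal I^c$, and if $i\in\mathcal I$, then $\hat u_i$ is a value $b$ that maximizes $\Pr(U_1^{i-1}=\hat u_1^{i-1},\,U_i=b)$, with ties broken arbitrarily. Let $T$ be the range of $f$ (the correctable error patterns) and $\Pi^N_K=\sum_{x\in T}|x\rangle\langle x|$. *Claim.* The failure probability of the compression protocol, $$P_\nu=1-\operatorname{Tr}\big(\Pi^N_K\,\bar\rho\big),\qquad \bar\rho=U_\rho^{\otimes N}\rho^{\otimes N}\big(U_\rho^{\otimes N}\big)^\dagger,$$ satisfies $\lim_{\nu\to\infty}P_\nu=0$. The protocol sends the $N-K\le\lceil N(H+\delta)\rceil$ frozen qubits, and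 the number of qubits sent per source qubit, $(N-K)/N$, converges to $\min\{H+\delta,1\}$ as $\nu\to\infty$; as $\delta>0$ is arbitrary, the rate can be brought arbitrarily close to the Schumacher limit $H$. -/

import Mathlib

open scoped Kronecker ComplexOrder

/-! ### Qubit sources

The computational basis of a qubit is indexed by `ZMod 2`, and that of `N` qubits by
`Fin N → ZMod 2`. -/

/-- A density matrix of a single qubit: positive semidefinite of trace one. -/
structure IsDensityMatrix (ρ : Matrix (ZMod 2) (ZMod 2) ℂ) : Prop where
  posSemidef : ρ.PosSemidef
  trace_eq_one : ρ.trace = 1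

/-- The von Neumann entropy `-Tr (ρ log₂ ρ) = -∑ λ log₂ λ` in bits, the sum being over the
eigenvalues of `ρ` with multiplicity (with `0 log 0 = 0`). -/
noncomputable def vonNeumannEntropy {ρ : Matrix (ZMod 2) (ZMod 2) ℂ} (hρ : ρ.IsHermitian) : ℝ :=
  -∑ i, hρ.eigenvalues i * Real.logb 2 (hρ.eigenvalues i)

/-- The `N`-fold tensor power `M^{⊗N}` of a one-qubit operator, in the computational basis. -/
def tensorPower (M : Matrix (ZMod 2) (ZMod 2) ℂ) (N : ℕ) :
    Matrix (Fin N → ZMod 2) (Fin N → ZMod 2) ℂ :=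
  Matrix.of fun x y => ∏ j, M (x j) (y j)

/-- The probability vector of a bit that equals `1` with probability `p`. -/
def bitMass (p : ℝ) (b : ZMod 2) : ℝ := if b = 0 then 1 - p else p

/-- `(1 - p) |0⟩⟨0| + p |1⟩⟨1|`. -/
def diagonalQubit (p : ℝ) : Matrix (ZMod 2) (ZMod 2) ℂ :=
  Matrix.diagonal fun b => (bitMass p b : ℂ)

/-! ### The polar transform -/

/-- The kernel `G₂ = [1 0; 1 1]`. -/
def polarKernel : Matrix (Fin 2) (Fin 2) (ZMod 2) := !![1, 0; 1, 1]

/-- The reverse shuffle: position `2k + b` goes to position `b * (N / 2) + k`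
(with positions counted from `0`, `b ∈ {0, 1}` and `N = 2 M`). -/
def reverseShuffle (M : ℕ) : Fin (M * 2) ≃ Fin (2 * M) :=
  finProdFinEquiv.symm.trans ((Equiv.prodComm (Fin M) (Fin 2)).trans finProdFinEquiv)

/-- The permutation matrix of the reverse shuffle, acting on row vectors by
`(s₁, …, s_N) ↦ (s₁, s₃, …, s_{N-1}, s₂, s₄, …, s_N)`. -/
def reverseShuffleMatrix (M : ℕ) : Matrix (Fin (M * 2)) (Fin (2 * M)) (ZMod 2) :=
  Matrix.of fun i j => if reverseShuffle M i = j then 1 else 0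

/-- The polar transform `G_N`, `N = 2 ^ ν`, given by `G₁ = 1` and
`G_N = (I_{N/2} ⊗ G₂) R_N (I₂ ⊗ G_{N/2})`. It acts on row vectors, `u ↦ u G_N`. -/
def polarTransform : (ν : ℕ) → Matrix (Fin (2 ^ ν)) (Fin (2 ^ ν)) (ZMod 2)
  | 0 => 1
  | ν + 1 =>
    (((1 : Matrix (Fin (2 ^ ν)) (Fin (2 ^ ν)) (ZMod 2)) ⊗ₖ polarKernel).reindex
          finProdFinEquiv finProdFinEquiv
        * reverseShuffleMatrix (2 ^ ν)
        * ((1 : Matrix (Fin 2) (Fin 2) (ZMod 2)) ⊗ₖ polarTransform ν).reindex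
          finProdFinEquiv finProdFinEquiv).reindex
      (finCongr (pow_succ 2 ν).symm) (finCongr (pow_succ' 2 ν).symm)

/-! ### Design of a polar code for the binary symmetric channel -/

/-- Transition probability `W(y | x)` of the binary symmetric channel with error probability `p`. -/
def bsc (p : ℝ) (x y : ZMod 2) : ℝ := bitMass p (y - x)

/-- The `i`-th effective channel of the polar transform over the binary symmetric channel. Its
input is the bit `u_i`, its output is `(y, u₁^{i-1})`, and the other input bits are uniform:
`W_N^{(i)}(y, v | b) = 2^{-(N-1)} ∑ W^N(y | u G_N)`, over all `u` with `u₁^{i-1} = v`, `u_i = b`. -/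
noncomputable def effectiveChannel (p : ℝ) {ν : ℕ} (i : Fin (2 ^ ν)) (b : ZMod 2)
    (o : (Fin (2 ^ ν) → ZMod 2) × ({j : Fin (2 ^ ν) // j < i} → ZMod 2)) : ℝ :=
  (1 / 2 : ℝ) ^ (2 ^ ν - 1) *
    ∑ u : Fin (2 ^ ν) → ZMod 2 with (∀ j, u j.1 = o.2 j) ∧ u i = b,
      ∏ j, bsc p (Matrix.vecMul u (polarTransform ν) j) (o.1 j)

/-- The (symmetric) capacity in bits of a binary-input channel `W(y | b) = W b y`: the mutual
information between a uniform input and the output. -/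
noncomputable def capacity {Y : Type*} [Fintype Y] (W : ZMod 2 → Y → ℝ) : ℝ :=
  ∑ y, ∑ b, 1 / 2 * W b y * Real.logb 2 (W b y / (1 / 2 * W 0 y + 1 / 2 * W 1 y))

/-- `A` is an information set of size `K` for a polar code of length `2 ^ ν` designed for the binary
symmetric channel with error probability `p`: it consists of `K` effective channels of largest
capacity (ties being broken arbitrarily). The remaining indices are frozen. -/
def IsPolarInformationSet (p : ℝ) (ν K : ℕ) (A : Finset (Fin (2 ^ ν))) : Prop :=
  A.card = K ∧ ∀ i ∈ A, ∀ j ∉ A, capacity (effectiveChannel p j) ≤ capacity (effectiveChannel p i)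

/-! ### The polar syndrome decoder -/

/-- The probability that `U₁^{i-1} = u₁^{i-1}` and `U_i = b`, where `U G_N = X` and the bits of `X`
are independent and equal to `1` with probability `p`. -/
def prefixMass (p : ℝ) {ν : ℕ} (u : Fin (2 ^ ν) → ZMod 2) (i : Fin (2 ^ ν)) (b : ZMod 2) : ℝ :=
  ∑ w : Fin (2 ^ ν) → ZMod 2 with (∀ j < i, w j = u j) ∧ w i = b,
    ∏ j, bitMass p (Matrix.vecMul w (polarTransform ν) j)

/-- `f` is a polar syndrome decoder, i.e. a successive cancellation decoder that maps a syndrome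
(the values of the frozen bits, those with index outside `A`) to an error pattern. It determines
`u₁, u₂, …` one after another: a frozen bit is read from the syndrome, and an information bit is set
to a value that is most likely given the bits before it (with any way of breaking ties). The
error pattern is then `u G_N`. -/
def IsPolarSyndromeDecoder (p : ℝ) {ν : ℕ} (A : Finset (Fin (2 ^ ν)))
    (f : ({j : Fin (2 ^ ν) // j ∉ A} → ZMod 2) → (Fin (2 ^ ν) → ZMod 2)) : Prop :=
  ∀ s, ∃ u : Fin (2 ^ ν) → ZMod 2,
    (∀ j : {j : Fin (2 ^ ν) // j ∉ A}, u j.1 = s j) ∧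
    (∀ i ∈ A, ∀ b, prefixMass p u i b ≤ prefixMass p u i (u i)) ∧
    f s = Matrix.vecMul u (polarTransform ν)

/-! ### The compression protocol -/

/-- The projector `∑_{x ∈ T} |x⟩⟨x|`, where `T` is the range of `f`. -/
def correctableProjector {ν : ℕ} {A : Finset (Fin (2 ^ ν))}
    (f : ({j : Fin (2 ^ ν) // j ∉ A} → ZMod 2) → (Fin (2 ^ ν) → ZMod 2)) :
    Matrix (Fin (2 ^ ν) → ZMod 2) (Fin (2 ^ ν) → ZMod 2) ℂ :=
  ∑ x ∈ Finset.univ.image f, Matrix.single x x 1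

/-- The failure probability `1 - Tr (Π ρ̄)` of the protocol, where `Π` projects onto the correctable
error patterns and `ρ̄ = U^{⊗N} ρ^{⊗N} (U^{⊗N})†` is the source state after the change of basis. -/
def failureProbability (ρ U : Matrix (ZMod 2) (ZMod 2) ℂ) {ν : ℕ} {A : Finset (Fin (2 ^ ν))}
    (f : ({j : Fin (2 ^ ν) // j ∉ A} → ZMod 2) → (Fin (2 ^ ν) → ZMod 2)) : ℂ :=
  1 - (correctableProjector f *
    (tensorPower U (2 ^ ν) * tensorPower ρ (2 ^ ν) * (tensorPower U (2 ^ ν)).conjTranspose)).trace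

/-! ### Binary sources with side information

A source is a joint mass function `P : Y → ZMod 2 → ℝ` of a side information `y` and a bit `b`. -/

section Source

open Real

/-! After the change of basis the state is `(U ρ U†)^{⊗N}`, diagonal with the law of `X` on the
diagonal, so the failure probability is the classical probability that `X` is not in the range of
`f` (`failureProbability_eq`). If `X = U G_N` is missed, then at some information index the true bit
is no more likely than its complement given the preceding true bits (`exists_isAmbiguous`). A union
bound therefore controls the failure by the sum of `2 H(U_i | U₁^{i-1})` over the information set
(`sum_compl_range_le`).

These entropies must be `o(1/N)`. One recursion step of `G_N` replaces two copies of a source by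
their minus and plus sources: the mean entropy is preserved, while the Bhattacharyya parameter `Z`
becomes at most `2 Z - Z²` and exactly `Z²`. Two potential functions replace martingale convergence.
The mean of `√Z` drops by a quarter of the mean of `√Z (1 - √Z)²`, so some level is nearly
polarized, and there entropy conservation bounds the fraction of non-small `Z` by `H + ε`. From
small `Z` onwards the mean of `Z^{1/4}` contracts by `13/20`, so that all but a fraction `H + ε` of
the indices reach `Z ≤ C 4^{-n}` (`IsPolarTree.eventually_le_card`).

Finally, an effective channel has capacity `1 - H(U_i | U₁^{i-1})` in bits
(`capacity_effectiveChannel`), so the code design selects the smallest entropies. These are all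
`O(4^{-ν})`, and their sum is `O(2^{-ν})`. -/

/-- The unnormalized entropy (in nats) of a bit with masses `a` and `b`. -/
noncomputable def bitEntropy (a b : ℝ) : ℝ := negMulLog a + negMulLog b - negMulLog (a + b)

theorem bitEntropy_comm (a b : ℝ) : bitEntropy a b = bitEntropy b a := by
  simp only [bitEntropy, add_comm]

theorem bitEntropy_mul (c a b : ℝ) : bitEntropy (c * a) (c * b) = c * bitEntropy a b := by
  simp only [bitEntropy, ← mul_add, negMulLog_mul]
  ring

theorem bitEntropy_zero_left (b : ℝ) : bitEntropy 0 b = 0 := by simp [bitEntropy]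

theorem bitEntropy_zero_right (a : ℝ) : bitEntropy a 0 = 0 := by simp [bitEntropy]

theorem bitEntropy_eq_log_div {a b : ℝ} (ha : 0 < a) (hb : 0 < b) :
    bitEntropy a b = -(a * log (a / (a + b))) - b * log (b / (a + b)) := by
  have h : 0 < a + b := by positivity
  rw [log_div ha.ne' h.ne', log_div hb.ne' h.ne']
  simp only [bitEntropy, negMulLog]
  ring

theorem two_mul_div_le_bitEntropy {a b : ℝ} (ha : 0 ≤ a) (hb : 0 ≤ b) :
    2 * (a * b / (a + b)) ≤ bitEntropy a b := by
  rcases ha.eq_or_lt with rfl | ha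
  · simp [bitEntropy_zero_left]
  rcases hb.eq_or_lt with rfl | hb
  · simp [bitEntropy_zero_right]
  have h : 0 < a + b := by positivity
  rw [bitEntropy_eq_log_div ha hb]
  have h1 := mul_le_mul_of_nonneg_left (log_le_sub_one_of_pos (div_pos ha h)) ha.le
  have h2 := mul_le_mul_of_nonneg_left (log_le_sub_one_of_pos (div_pos hb h)) hb.le
  have h3 : 2 * (a * b / (a + b)) = -(a * (a / (a + b) - 1)) - b * (b / (a + b) - 1) := by
    field_simp
    ring
  linarith

theorem bitEntropy_nonneg {a b : ℝ} (ha : 0 ≤ a) (hb : 0 ≤ b) : 0 ≤ bitEntropy a b :=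
  le_trans (by positivity) (two_mul_div_le_bitEntropy ha hb)

theorem min_le_bitEntropy {a b : ℝ} (ha : 0 ≤ a) (hb : 0 ≤ b) : min a b ≤ bitEntropy a b := by
  refine le_trans ?_ (two_mul_div_le_bitEntropy ha hb)
  wlog hab : a ≤ b generalizing a b
  · rw [min_comm, mul_comm a, add_comm]
    exact this hb ha (le_of_not_ge hab)
  rw [min_eq_left hab]
  rcases hb.eq_or_lt with rfl | hb
  · simpa using hab
  rw [← mul_div_assoc, le_div_iff₀ (by positivity)]
  nlinarith

/-- This is `log x ≤ x - 1` at `x = 2a/(a+b)` and `x = 2b/(a+b)`, which is sharp for the uniform bit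
`a = b`. It forces entropy close to `log 2` when the Bhattacharyya parameter is close to one. -/
theorem le_bitEntropy {a b : ℝ} (ha : 0 ≤ a) (hb : 0 ≤ b) :
    (log 2 - 1) * (a + b) + 4 * (a * b / (a + b)) ≤ bitEntropy a b := by
  have hlog : log 2 ≤ 1 := (log_le_sub_one_of_pos (by norm_num)).trans (by norm_num)
  rcases ha.eq_or_lt with rfl | ha
  · simp only [bitEntropy_zero_left, zero_mul, zero_div, mul_zero, zero_add, add_zero]
    nlinarith
  rcases hb.eq_or_lt with rfl | hb
  · simp only [bitEntropy_zero_right, mul_zero, zero_div, add_zero]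
    nlinarith
  have h : 0 < a + b := by positivity
  rw [bitEntropy_eq_log_div ha hb]
  have h1 := mul_le_mul_of_nonneg_left
    (log_le_sub_one_of_pos (show 0 < 2 * (a / (a + b)) by positivity)) ha.le
  have h2 := mul_le_mul_of_nonneg_left
    (log_le_sub_one_of_pos (show 0 < 2 * (b / (a + b)) by positivity)) hb.le
  rw [log_mul two_ne_zero (by positivity)] at h1 h2
  have h3 : 4 * (a * b / (a + b)) - (a + b) =
      -(a * (2 * (a / (a + b)) - 1)) - b * (2 * (b / (a + b)) - 1) := by
    field_simp
    ring
  linarith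

/-- Write the logarithm as twice that of a ratio of square roots, apply `log x ≤ x - 1`, and use
subadditivity of the square root. -/
theorem neg_mul_log_div_le {a b : ℝ} (ha : 0 < a) (hb : 0 < b) :
    -(a * log (a / (a + b))) ≤ 2 * √(a * b) := by
  have h : 0 < a + b := by positivity
  have hs : √(a + b) ≤ √a + √b := by
    refine sqrt_le_iff.2 ⟨by positivity, ?_⟩
    nlinarith [sq_sqrt ha.le, sq_sqrt hb.le, mul_nonneg (sqrt_nonneg a) (sqrt_nonneg b)]
  have h1 : log (√(a + b) / √a) = -log (a / (a + b)) / 2 := by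
    rw [← sqrt_div h.le, log_sqrt (by positivity), ← log_inv, inv_div]
  have h2 := mul_le_mul_of_nonneg_left
    (log_le_sub_one_of_pos (show 0 < √(a + b) / √a by positivity)) ha.le
  have h3 : a * (√(a + b) / √a - 1) = √a * (√(a + b) - √a) := by
    have := sq_sqrt ha.le
    field_simp
    rw [this]
  rw [h3, h1] at h2
  rw [sqrt_mul ha.le]
  nlinarith [mul_le_mul_of_nonneg_left hs (sqrt_nonneg a)]

theorem bitEntropy_le {a b : ℝ} (ha : 0 ≤ a) (hb : 0 ≤ b) : bitEntropy a b ≤ 4 * √(a * b) := by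
  rcases ha.eq_or_lt with rfl | ha
  · simp [bitEntropy_zero_left]
  rcases hb.eq_or_lt with rfl | hb
  · simp [bitEntropy_zero_right]
  rw [bitEntropy_eq_log_div ha hb]
  have h1 := neg_mul_log_div_le ha hb
  have h2 := neg_mul_log_div_le hb ha
  rw [mul_comm b a, add_comm b a] at h2
  linarith

/-! ### Conditional entropy against the Bhattacharyya parameter. -/

variable {Y : Type*} [Fintype Y]

/-- The conditional entropy (in nats) of the bit given the side information. -/
noncomputable def condEntropy (P : Y → ZMod 2 → ℝ) : ℝ := ∑ y, bitEntropy (P y 0) (P y 1)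

/-- The Bhattacharyya parameter of a source. -/
noncomputable def bhattacharyya (P : Y → ZMod 2 → ℝ) : ℝ := ∑ y, 2 * √(P y 0 * P y 1)

/-- A nonnegative mass function of total mass one. -/
structure IsSource (P : Y → ZMod 2 → ℝ) : Prop where
  nonneg : ∀ y b, 0 ≤ P y b
  sum_eq_one : ∑ y, (P y 0 + P y 1) = 1

/-- The sum of the bits of two independent copies of the source, given both side informations. -/
def minusSource (P : Y → ZMod 2 → ℝ) (y : Y × Y) (b : ZMod 2) : ℝ :=
  P y.1 b * P y.2 0 + P y.1 (b + 1) * P y.2 1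

/-- The bit of the second of two independent copies of the source, given both side informations and
the sum of the two bits. -/
def plusSource (P : Y → ZMod 2 → ℝ) (y : (Y × Y) × ZMod 2) (b : ZMod 2) : ℝ :=
  P y.1.1 (y.2 + b) * P y.1.2 b

theorem sum_zmod_two {M : Type*} [AddCommMonoid M] (g : ZMod 2 → M) : ∑ b, g b = g 0 + g 1 :=
  Fin.sum_univ_two g

theorem one_add_one_zmod_two : (1 : ZMod 2) + 1 = 0 := rfl

namespace IsSource

variable {P : Y → ZMod 2 → ℝ}

theorem condEntropy_nonneg (hP : IsSource P) : 0 ≤ condEntropy P :=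
  Finset.sum_nonneg fun y _ => bitEntropy_nonneg (hP.nonneg y 0) (hP.nonneg y 1)

theorem sum_min_le_condEntropy (hP : IsSource P) : ∑ y, min (P y 0) (P y 1) ≤ condEntropy P :=
  Finset.sum_le_sum fun y _ => min_le_bitEntropy (hP.nonneg y 0) (hP.nonneg y 1)

theorem condEntropy_le (hP : IsSource P) : condEntropy P ≤ 2 * bhattacharyya P := by
  rw [bhattacharyya, Finset.mul_sum]
  refine Finset.sum_le_sum fun y _ => ?_
  linarith [bitEntropy_le (hP.nonneg y 0) (hP.nonneg y 1)]

theorem bhattacharyya_nonneg (P : Y → ZMod 2 → ℝ) : 0 ≤ bhattacharyya P :=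
  Finset.sum_nonneg fun y _ => by positivity

theorem two_mul_sqrt_le {a b : ℝ} (ha : 0 ≤ a) (hb : 0 ≤ b) : 2 * √(a * b) ≤ a + b := by
  rw [sqrt_mul ha]
  nlinarith [sq_nonneg (√a - √b), sq_sqrt ha, sq_sqrt hb]

theorem bhattacharyya_le_one (hP : IsSource P) : bhattacharyya P ≤ 1 := by
  rw [← hP.sum_eq_one]
  exact Finset.sum_le_sum fun y _ => two_mul_sqrt_le (hP.nonneg y 0) (hP.nonneg y 1)

/-- Cauchy–Schwarz, with the square of each term split as `4ab/(a+b)` times the mass `a + b`. -/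
theorem bhattacharyya_sq_le (hP : IsSource P) :
    bhattacharyya P ^ 2 ≤ ∑ y, 4 * (P y 0 * P y 1 / (P y 0 + P y 1)) := by
  have h := Finset.sum_sq_le_sum_mul_sum_of_sq_le_mul (R := ℝ) Finset.univ
    (r := fun y => 2 * √(P y 0 * P y 1))
    (f := fun y => 4 * (P y 0 * P y 1 / (P y 0 + P y 1))) (g := fun y => P y 0 + P y 1)
    (fun y _ => by have := hP.nonneg y 0; have := hP.nonneg y 1; positivity)
    (fun y _ => add_nonneg (hP.nonneg y 0) (hP.nonneg y 1))
    (fun y _ => by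
      have h0 := hP.nonneg y 0
      have h1 := hP.nonneg y 1
      rw [mul_pow, sq_sqrt (by positivity)]
      rcases (add_nonneg h0 h1).eq_or_lt with h | h
      · have : P y 0 = 0 := by linarith
        simp [this]
      · apply le_of_eq
        field_simp
        ring)
  rwa [hP.sum_eq_one, mul_one] at h

theorem le_condEntropy (hP : IsSource P) : log 2 - 1 + bhattacharyya P ^ 2 ≤ condEntropy P := by
  refine (add_le_add_right hP.bhattacharyya_sq_le _).trans ?_
  calc log 2 - 1 + ∑ y, 4 * (P y 0 * P y 1 / (P y 0 + P y 1))
      = ∑ y, ((log 2 - 1) * (P y 0 + P y 1) + 4 * (P y 0 * P y 1 / (P y 0 + P y 1))) := by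
        rw [Finset.sum_add_distrib, ← Finset.mul_sum (f := fun y => P y 0 + P y 1), hP.sum_eq_one,
          mul_one]
    _ ≤ condEntropy P :=
        Finset.sum_le_sum fun y _ => le_bitEntropy (hP.nonneg y 0) (hP.nonneg y 1)

/-! ### One polarization step. -/

theorem bhattacharyya_plusSource (hP : IsSource P) :
    bhattacharyya (plusSource P) = bhattacharyya P ^ 2 := by
  simp only [bhattacharyya, plusSource, Fintype.sum_prod_type, sum_zmod_two, sq,
    Finset.sum_mul_sum, zero_add, add_zero, one_add_one_zmod_two]
  refine Finset.sum_congr rfl fun y _ => Finset.sum_congr rfl fun z _ => ?_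
  have e1 : P y 0 * P z 0 * (P y 1 * P z 1) = (P y 0 * P y 1) * (P z 0 * P z 1) := by ring
  have e2 : P y 1 * P z 0 * (P y 0 * P z 1) = (P y 0 * P y 1) * (P z 0 * P z 1) := by ring
  rw [e1, e2, sqrt_mul (mul_nonneg (hP.nonneg _ _) (hP.nonneg _ _))]
  ring

theorem sqrt_mix_le {a b c d : ℝ} (ha : 0 ≤ a) (hb : 0 ≤ b) (hc : 0 ≤ c) (hd : 0 ≤ d) :
    √((a * c + b * d) * (b * c + a * d)) ≤
      (a + b) * √(c * d) + (c + d) * √(a * b) - 2 * √(a * b) * √(c * d) := by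
  have hs := two_mul_sqrt_le ha hb
  have ht := two_mul_sqrt_le hc hd
  have hs2 := sq_sqrt (mul_nonneg ha hb)
  have ht2 := sq_sqrt (mul_nonneg hc hd)
  have hs0 := sqrt_nonneg (a * b)
  have ht0 := sqrt_nonneg (c * d)
  generalize √(a * b) = s at *
  generalize √(c * d) = t at *
  apply sqrt_le_iff.2
  constructor
  · nlinarith [mul_nonneg hs0 hd, mul_nonneg hs0 hc, mul_nonneg ht0 ha, mul_nonneg ht0 hb]
  · have h1 : (a * c + b * d) * (b * c + a * d) =
        (a + b) ^ 2 * t ^ 2 + s ^ 2 * (c + d) ^ 2 - 4 * s ^ 2 * t ^ 2 := by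
      rw [hs2, ht2]
      ring
    -- Twice this product is exactly the square of the right-hand side minus the square of the
    -- left-hand side.
    have h2 : 0 ≤ s * t * ((a + b - 2 * s) * (c + d - 2 * t)) :=
      mul_nonneg (mul_nonneg hs0 ht0) (mul_nonneg (by linarith) (by linarith))
    rw [h1]
    nlinarith

theorem bhattacharyya_minusSource_le (hP : IsSource P) :
    bhattacharyya (minusSource P) ≤ 2 * bhattacharyya P - bhattacharyya P ^ 2 := by
  have h1 : ∑ y, ∑ z, (2 * ((P y 0 + P y 1) * √(P z 0 * P z 1) +
      (P z 0 + P z 1) * √(P y 0 * P y 1) - 2 * √(P y 0 * P y 1) * √(P z 0 * P z 1))) =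
      2 * bhattacharyya P - bhattacharyya P ^ 2 := by
    calc _ = (∑ y, (P y 0 + P y 1)) * bhattacharyya P +
          bhattacharyya P * (∑ z, (P z 0 + P z 1)) - bhattacharyya P * bhattacharyya P := by
          simp only [bhattacharyya, Finset.sum_mul_sum, ← Finset.sum_add_distrib,
            ← Finset.sum_sub_distrib]
          refine Finset.sum_congr rfl fun y _ => Finset.sum_congr rfl fun z _ => ?_
          ring
      _ = _ := by rw [hP.sum_eq_one]; ring
  rw [← h1, bhattacharyya, Fintype.sum_prod_type]
  refine Finset.sum_le_sum fun y _ => Finset.sum_le_sum fun z _ => ?_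
  simp only [minusSource, zero_add, one_add_one_zmod_two]
  exact mul_le_mul_of_nonneg_left
    (sqrt_mix_le (hP.nonneg y 0) (hP.nonneg y 1) (hP.nonneg z 0) (hP.nonneg z 1)) zero_le_two

/-- The chain rule: `(b₁, b₂) ↦ (b₁ + b₂, b₂)` is invertible, so the two new entropies add up to
that of two independent copies. -/
theorem condEntropy_minusSource_add_condEntropy_plusSource (hP : IsSource P) :
    condEntropy (minusSource P) + condEntropy (plusSource P) = 2 * condEntropy P := by
  calc _ = ∑ y, ∑ z, ((P y 0 + P y 1) * bitEntropy (P z 0) (P z 1) +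
        (P z 0 + P z 1) * bitEntropy (P y 0) (P y 1)) := by
        simp only [condEntropy, Fintype.sum_prod_type, sum_zmod_two, ← Finset.sum_add_distrib]
        refine Finset.sum_congr rfl fun y _ => Finset.sum_congr rfl fun z _ => ?_
        simp only [minusSource, plusSource, zero_add, add_zero, one_add_one_zmod_two, bitEntropy]
        rw [show P y 0 * P z 0 + P y 1 * P z 1 + (P y 1 * P z 0 + P y 0 * P z 1) =
          (P y 0 + P y 1) * (P z 0 + P z 1) by ring]
        simp only [negMulLog_mul]
        ring
    _ = (∑ y, (P y 0 + P y 1)) * condEntropy P + condEntropy P * ∑ z, (P z 0 + P z 1) := by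
        simp only [condEntropy, Finset.sum_mul_sum, ← Finset.sum_add_distrib]
        refine Finset.sum_congr rfl fun y _ => Finset.sum_congr rfl fun z _ => ?_
        ring
    _ = _ := by rw [hP.sum_eq_one]; ring

end IsSource

end Source

/-! ### Polarization of a binary tree of parameters -/

section PolarTree

open Real

theorem sum_range_two_mul {M : Type*} [AddCommMonoid M] (g : ℕ → M) (n : ℕ) :
    ∑ i ∈ Finset.range (2 * n), g i =
      ∑ i ∈ Finset.range n, (g (2 * i) + g (2 * i + 1)) := by
  induction n with
  | zero => simp
  | succ n ih =>
    rw [Finset.sum_range_succ, ← ih, mul_add, mul_one, Finset.sum_range_succ,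
      Finset.sum_range_succ, add_assoc]

theorem sum_range_mul {M : Type*} [AddCommMonoid M] (g : ℕ → M) (n k : ℕ) :
    ∑ i ∈ Finset.range (n * k), g i =
      ∑ i ∈ Finset.range n, ∑ j ∈ Finset.range k, g (i * k + j) := by
  induction n with
  | zero => simp
  | succ n ih => rw [Finset.sum_range_succ, ← ih, add_mul, one_mul, Finset.sum_range_add]

/-- A family of Bhattacharyya parameters `Z n i` and entropies `E n i`, where `(n + 1, 2 i)` and
`(n + 1, 2 i + 1)` are the children of `(n, i)`. -/
structure IsPolarTree (Z E : ℕ → ℕ → ℝ) : Prop where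
  nonneg : ∀ n i, 0 ≤ Z n i
  le_one : ∀ n i, Z n i ≤ 1
  minus_le : ∀ n i, Z (n + 1) (2 * i) ≤ 2 * Z n i - Z n i ^ 2
  plus_le : ∀ n i, Z (n + 1) (2 * i + 1) ≤ Z n i ^ 2
  entropy_nonneg : ∀ n i, 0 ≤ E n i
  entropy_add : ∀ n i, E (n + 1) (2 * i) + E (n + 1) (2 * i + 1) = 2 * E n i
  le_entropy : ∀ n, ∀ i < 2 ^ n, log 2 - 1 + Z n i ^ 2 ≤ E n i

namespace IsPolarTree

variable {Z E : ℕ → ℕ → ℝ}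

theorem sum_entropy (h : IsPolarTree Z E) (n : ℕ) :
    ∑ i ∈ Finset.range (2 ^ n), E n i = 2 ^ n * E 0 0 := by
  induction n with
  | zero => simp
  | succ n ih =>
    rw [pow_succ', sum_range_two_mul, Finset.sum_congr rfl fun i _ => h.entropy_add n i,
      ← Finset.mul_sum, ih]
    ring

/-- With `w = √Z`, the children contribute at most `w²` and `w √(2 - w²) ≤ w (1 + (1 - w²)/2)`. The
sum of these bounds falls short of `2 w` by exactly `w (1 - w)²/2`. -/
theorem sqrt_add_sqrt_le (h : IsPolarTree Z E) (n i : ℕ) :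
    √(Z (n + 1) (2 * i)) + √(Z (n + 1) (2 * i + 1)) ≤
      2 * √(Z n i) - √(Z n i) * (1 - √(Z n i)) ^ 2 / 2 := by
  have hz := h.nonneg n i
  have hz1 := h.le_one n i
  have hp : √(Z (n + 1) (2 * i + 1)) ≤ √(Z n i) ^ 2 := by
    rw [sq_sqrt hz]
    exact sqrt_le_iff.2 ⟨hz, h.plus_le n i⟩
  have hm : √(Z (n + 1) (2 * i)) ≤ √(Z n i) * (1 + (1 - √(Z n i) ^ 2) / 2) := by
    refine (sqrt_le_sqrt (h.minus_le n i)).trans ?_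
    rw [sq_sqrt hz]
    apply sqrt_le_iff.2
    constructor
    · exact mul_nonneg (sqrt_nonneg _) (by linarith)
    · rw [mul_pow, sq_sqrt hz]
      nlinarith [mul_nonneg hz (sq_nonneg (1 - Z n i))]
  nlinarith

/-- Otherwise the mean of `√Z`, which starts at most at one, would drop by at least `η/4` at every
level and become negative. -/
theorem exists_sum_sqrt_mul_le (h : IsPolarTree Z E) {η : ℝ} (hη : 0 < η) :
    ∃ n, ∑ i ∈ Finset.range (2 ^ n), √(Z n i) * (1 - √(Z n i)) ^ 2 ≤ η * 2 ^ n := by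
  by_contra! hc
  have key : ∀ n, ∑ i ∈ Finset.range (2 ^ n), √(Z n i) ≤ 2 ^ n * (1 - n * (η / 4)) := by
    intro n
    induction n with
    | zero => simpa using h.le_one 0 0
    | succ n ih =>
      rw [pow_succ', sum_range_two_mul]
      refine (Finset.sum_le_sum fun i _ => h.sqrt_add_sqrt_le n i).trans ?_
      rw [Finset.sum_sub_distrib, ← Finset.mul_sum, ← Finset.sum_div]
      have := hc n
      push_cast
      rw [pow_succ']
      linarith
  obtain ⟨n, hn⟩ := exists_nat_gt (4 / η)
  have h1 : 0 ≤ ∑ i ∈ Finset.range (2 ^ n), √(Z n i) := Finset.sum_nonneg fun i _ => sqrt_nonneg _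
  have h2 : 1 - n * (η / 4) < 0 := by
    rw [div_lt_iff₀ hη] at hn
    linarith
  have h3 : (2 : ℝ) ^ n * (1 - n * (η / 4)) < 0 := mul_neg_of_pos_of_neg (by positivity) h2
  linarith [key n]

/-- A bound on the indicator of `ζ < Z n i` whose average is small for some `n`. -/
theorem one_le_of_lt (h : IsPolarTree Z E) {ζ ε : ℝ} (hζ : 0 < ζ) (hε : 0 < ε) {n i : ℕ}
    (hi : i < 2 ^ n) (hz : ζ < Z n i) :
    1 ≤ (4 / log 2) ^ 2 / (4 * ε * √ζ) * (√(Z n i) * (1 - √(Z n i)) ^ 2) +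
      E n i / log 2 + ε := by
  have hl : 0 < log 2 := log_pos (by norm_num)
  have hE := h.le_entropy n i hi
  have hw : √ζ ≤ √(Z n i) := sqrt_le_sqrt hz.le
  have hs : 0 < √ζ := sqrt_pos.2 hζ
  have hw1 : √(Z n i) ≤ 1 := sqrt_le_one.2 (h.le_one n i)
  have hz2 := sq_sqrt (h.nonneg n i)
  have hz1 := h.le_one n i
  have hz0 := h.nonneg n i
  set w := √(Z n i)
  -- `Z² = w⁴`, so this is Bernoulli's inequality at `w = 1`.
  have h1 : 1 - Z n i ^ 2 ≤ 4 * (1 - w) := by nlinarith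
  have h2 : 1 - 4 * (1 - w) / log 2 ≤ E n i / log 2 := by
    rw [one_sub_div hl.ne']
    gcongr
    linarith
  -- AM-GM trades the linear defect for a quadratic one plus `ε`; the lower bound on `Z` then
  -- supplies the missing factor `w`.
  have h3 : 4 / log 2 * (1 - w) ≤ (4 / log 2) ^ 2 / (4 * ε) * (1 - w) ^ 2 + ε := by
    rw [← sub_nonneg]
    have : (4 / log 2) ^ 2 / (4 * ε) * (1 - w) ^ 2 + ε - 4 / log 2 * (1 - w) =
        (4 / log 2 * (1 - w) - 2 * ε) ^ 2 / (4 * ε) := by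
      field_simp
      ring
    rw [this]
    positivity
  have h4 : (4 / log 2) ^ 2 / (4 * ε) * (1 - w) ^ 2 ≤
      (4 / log 2) ^ 2 / (4 * ε * √ζ) * (w * (1 - w) ^ 2) := by
    have : (4 / log 2) ^ 2 / (4 * ε) * (1 - w) ^ 2 =
        (4 / log 2) ^ 2 / (4 * ε * √ζ) * (√ζ * (1 - w) ^ 2) := by
      field_simp
    rw [this]
    gcongr
  have h5 : 4 * (1 - w) / log 2 = 4 / log 2 * (1 - w) := by ring
  linarith

theorem exists_card_le (h : IsPolarTree Z E) {ζ ε : ℝ} (hζ : 0 < ζ) (hε : 0 < ε) :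
    ∃ n, (∑ i ∈ Finset.range (2 ^ n), if ζ < Z n i then (1 : ℝ) else 0) ≤
      2 ^ n * (E 0 0 / log 2 + ε) := by
  have hl : 0 < log 2 := log_pos (by norm_num)
  set C := (4 / log 2) ^ 2 / (4 * (ε / 2) * √ζ) with hC
  have hs : 0 < √ζ := sqrt_pos.2 hζ
  have hC0 : 0 < C := by positivity
  -- With this `η` the polarization defect contributes `C η = ε/2` to the mean.
  obtain ⟨n, hn⟩ := h.exists_sum_sqrt_mul_le (η := ε / 2 / C) (by positivity)
  refine ⟨n, ?_⟩
  calc _ ≤ ∑ i ∈ Finset.range (2 ^ n),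
        (C * (√(Z n i) * (1 - √(Z n i)) ^ 2) + E n i / log 2 + ε / 2) := by
        refine Finset.sum_le_sum fun i hi => ?_
        split_ifs with hz
        · exact h.one_le_of_lt hζ (half_pos hε) (Finset.mem_range.1 hi) hz
        · have := h.entropy_nonneg n i
          positivity
    _ = C * ∑ i ∈ Finset.range (2 ^ n), √(Z n i) * (1 - √(Z n i)) ^ 2 +
        2 ^ n * (E 0 0 / log 2 + ε / 2) := by
        rw [Finset.sum_add_distrib, Finset.sum_add_distrib, ← Finset.mul_sum, ← Finset.sum_div,
          h.sum_entropy]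
        simp
        ring
    _ ≤ C * (ε / 2 / C * 2 ^ n) + 2 ^ n * (E 0 0 / log 2 + ε / 2) := by gcongr
    _ = _ := by
        field_simp
        ring

/-- With `q = Z^{1/4} ≤ 1/10`, the plus child gives `q² ≤ q/10`, and the minus child at most
`2^{1/4} q ≤ 1.2 q`, since `1.2⁴ > 2`. -/
theorem sqrt_sqrt_add_le (h : IsPolarTree Z E) {n i : ℕ} (hz : Z n i ≤ 1 / 10000) :
    √√(Z (n + 1) (2 * i)) + √√(Z (n + 1) (2 * i + 1)) ≤ 13 / 10 * √√(Z n i) := by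
  have hz0 := h.nonneg n i
  have hp : √√(Z (n + 1) (2 * i + 1)) ≤ √√(Z n i) * √√(Z n i) := by
    rw [mul_self_sqrt (sqrt_nonneg _)]
    exact sqrt_le_sqrt (sqrt_le_iff.2 ⟨hz0, h.plus_le n i⟩)
  have hm : √√(Z (n + 1) (2 * i)) ≤ 12 / 10 * √√(Z n i) := by
    have h1 : Z (n + 1) (2 * i) ≤ (144 / 100) ^ 2 * Z n i := by
      nlinarith [h.minus_le n i, sq_nonneg (Z n i)]
    refine (sqrt_le_sqrt (sqrt_le_sqrt h1)).trans ?_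
    rw [sqrt_mul (by norm_num), sqrt_sq (by norm_num), sqrt_mul (by norm_num),
      show (144 / 100 : ℝ) = (12 / 10) ^ 2 by norm_num, sqrt_sq (by norm_num)]
  have hq : √√(Z n i) ≤ 1 / 10 := by
    rw [sqrt_le_iff, sqrt_le_iff]
    norm_num at hz ⊢
    exact hz
  nlinarith [sqrt_nonneg √(Z n i)]

/-- Once a parameter is small, most of its descendants decay exponentially. -/
theorem card_descendants_le (h : IsPolarTree Z E) {τ : ℝ} (hτ : 0 < τ) (k n i : ℕ) :
    (∑ j ∈ Finset.range (2 ^ k), if τ ^ 4 < Z (n + k) (i * 2 ^ k + j) then (1 : ℝ) else 0) ≤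
      2 ^ k * (10000 * Z n i + √√(Z n i) / τ * (13 / 20) ^ k) := by
  induction k generalizing n i with
  | zero =>
    have hz := h.nonneg n i
    simp only [pow_zero, Finset.range_one, Finset.sum_singleton, mul_one, add_zero, one_mul]
    split_ifs with ht
    -- Markov's inequality for `Z^{1/4}` in its pointwise form.
    · have : τ ≤ √√(Z n i) := by
        apply le_sqrt_of_sq_le
        apply le_sqrt_of_sq_le
        nlinarith
      have : 1 ≤ √√(Z n i) / τ := by rwa [le_div_iff₀ hτ, one_mul]
      linarith
    · positivity
  | succ k ih =>
    have hz := h.nonneg n i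
    -- The induction peels off the step at the root. Below the threshold `Z^{1/4}` contracts and `Z`
    -- does not grow on average; above it, `10000 Z > 1` makes the bound trivial. The linear term
    -- thus pays for paths that leave the contracting region.
    by_cases hs : Z n i ≤ 1 / 10000
    · have e0 : n + (k + 1) = n + 1 + k := by ring
      have e1 : ∀ j, i * 2 ^ (k + 1) + j = 2 * i * 2 ^ k + j := by
        intro j
        ring
      have e2 : ∀ j, i * 2 ^ (k + 1) + (2 ^ k + j) = (2 * i + 1) * 2 ^ k + j := by
        intro j
        ring
      rw [pow_succ' 2 k, two_mul, Finset.sum_range_add]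
      have i1 := ih (n + 1) (2 * i)
      have i2 := ih (n + 1) (2 * i + 1)
      have hq := h.sqrt_sqrt_add_le hs
      have hZ : Z (n + 1) (2 * i) + Z (n + 1) (2 * i + 1) ≤ 2 * Z n i := by
        linarith [h.minus_le n i, h.plus_le n i]
      rw [show 2 ^ k + 2 ^ k = 2 ^ (k + 1) by ring]
      simp only [e2, e1, e0]
      refine (add_le_add i1 i2).trans ?_
      have hr : (0 : ℝ) ≤ (13 / 20) ^ k / τ := by positivity
      calc _ = 2 ^ k * (10000 * (Z (n + 1) (2 * i) + Z (n + 1) (2 * i + 1)) +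
            (√√(Z (n + 1) (2 * i)) + √√(Z (n + 1) (2 * i + 1))) * ((13 / 20) ^ k / τ)) := by ring
        _ ≤ 2 ^ k * (10000 * (2 * Z n i) + 13 / 10 * √√(Z n i) * ((13 / 20) ^ k / τ)) := by gcongr
        _ = _ := by ring
    · calc _ ≤ ∑ j ∈ Finset.range (2 ^ (k + 1)), (1 : ℝ) :=
            Finset.sum_le_sum fun j _ => by split_ifs <;> norm_num
        _ = 2 ^ (k + 1) * 1 := by simp
        _ ≤ _ := by
            gcongr
            have : 0 ≤ √√(Z n i) / τ * (13 / 20) ^ (k + 1) := by positivity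
            linarith

theorem sum_indicator_le (h : IsPolarTree Z E) {ε : ℝ} (hε : 0 < ε) :
    ∃ C : ℝ, ∀ᶠ n : ℕ in Filter.atTop,
      (∑ i ∈ Finset.range (2 ^ n), if C * (1 / 4) ^ n < Z n i then (1 : ℝ) else 0) ≤
        2 ^ n * (E 0 0 / log 2 + ε) := by
  obtain ⟨m, hm⟩ := h.exists_card_le (ζ := ε / 3 / 10000) (ε := ε / 3) (by positivity)
    (by positivity)
  have hlim : Filter.Tendsto (fun k : ℕ => (13 / 14 : ℝ) ^ k) Filter.atTop (nhds 0) :=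
    tendsto_pow_atTop_nhds_zero_of_lt_one (by norm_num) (by norm_num)
  have hev := hlim.eventually (gt_mem_nhds (show 0 < ε / 3 by positivity))
  obtain ⟨k₀, hk₀⟩ := Filter.eventually_atTop.1 hev
  -- The factor `4 ^ m` offsets the first `m` levels, which are spent on polarization.
  refine ⟨4 ^ m, Filter.eventually_atTop.2 ⟨m + k₀, fun n hn => ?_⟩⟩
  obtain ⟨k, rfl⟩ := Nat.exists_eq_add_of_le ((Nat.le_add_right m k₀).trans hn)
  have hk := hk₀ k (by omega)
  -- `0.7⁴ < 1/4` gives the decay wanted, and `0.65/0.7 = 13/14 < 1` still makes the Markov bound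
  -- vanish.
  set τ : ℝ := (7 / 10) ^ k
  have hτ : 0 < τ := by positivity
  have hle : τ ^ 4 ≤ 4 ^ m * (1 / 4) ^ (m + k) := by
    rw [pow_add, ← mul_assoc, ← mul_pow, show (4 : ℝ) * (1 / 4) = 1 by norm_num, one_pow, one_mul,
      ← pow_mul, mul_comm k 4, pow_mul]
    exact pow_le_pow_left₀ (by norm_num) (by norm_num) k
  calc _ ≤ ∑ i ∈ Finset.range (2 ^ m * 2 ^ k), if τ ^ 4 < Z (m + k) i then (1 : ℝ) else 0 := by
        rw [pow_add 2 m k]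
        refine Finset.sum_le_sum fun i _ => ?_
        by_cases h1 : 4 ^ m * (1 / 4) ^ (m + k) < Z (m + k) i
        · rw [if_pos h1, if_pos (hle.trans_lt h1)]
        · rw [if_neg h1]
          split_ifs <;> norm_num
    _ = ∑ i ∈ Finset.range (2 ^ m), ∑ j ∈ Finset.range (2 ^ k),
        if τ ^ 4 < Z (m + k) (i * 2 ^ k + j) then (1 : ℝ) else 0 := sum_range_mul _ _ _
    _ ≤ ∑ i ∈ Finset.range (2 ^ m), 2 ^ k *
        ((if ε / 3 / 10000 < Z m i then (1 : ℝ) else 0) + 2 * (ε / 3)) := by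
        refine Finset.sum_le_sum fun i _ => ?_
        split_ifs with hz
        · calc _ ≤ ∑ j ∈ Finset.range (2 ^ k), (1 : ℝ) :=
                Finset.sum_le_sum fun j _ => by split_ifs <;> norm_num
            _ = 2 ^ k * 1 := by simp
            _ ≤ _ := by
                gcongr
                linarith
        · refine (h.card_descendants_le hτ k m i).trans
            (mul_le_mul_of_nonneg_left ?_ (by positivity))
          have h1 : √√(Z m i) ≤ 1 := sqrt_le_one.2 (sqrt_le_one.2 (h.le_one m i))
          have h2 : √√(Z m i) / τ * (13 / 20) ^ k ≤ 1 / τ * (13 / 20) ^ k := by gcongr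
          have h3 : 1 / τ * (13 / 20) ^ k = (13 / 14) ^ k := by
            rw [one_div, ← inv_pow, ← mul_pow]
            norm_num
          linarith
    _ = 2 ^ k * ((∑ i ∈ Finset.range (2 ^ m), if ε / 3 / 10000 < Z m i then (1 : ℝ) else 0) +
        2 ^ m * (2 * (ε / 3))) := by
        rw [← Finset.mul_sum, Finset.sum_add_distrib]
        simp
    _ ≤ 2 ^ k * (2 ^ m * (E 0 0 / log 2 + ε / 3) + 2 ^ m * (2 * (ε / 3))) := by gcongr
    _ = _ := by ring

theorem eventually_le_card (h : IsPolarTree Z E) {ε : ℝ} (hε : 0 < ε) :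
    ∃ C : ℝ, ∀ᶠ n : ℕ in Filter.atTop, (1 - E 0 0 / log 2 - ε) * 2 ^ n ≤
      (((Finset.range (2 ^ n)).filter fun i => Z n i ≤ C * (1 / 4) ^ n).card : ℝ) := by
  obtain ⟨C, hC⟩ := h.sum_indicator_le hε
  refine ⟨C, hC.mono fun n hn => ?_⟩
  have h1 : (∑ i ∈ Finset.range (2 ^ n), if C * (1 / 4) ^ n < Z n i then (1 : ℝ) else 0) +
      ∑ i ∈ Finset.range (2 ^ n), (if Z n i ≤ C * (1 / 4) ^ n then (1 : ℝ) else 0) = 2 ^ n := by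
    rw [← Finset.sum_add_distrib]
    calc _ = ∑ i ∈ Finset.range (2 ^ n), (1 : ℝ) := by
          refine Finset.sum_congr rfl fun i _ => ?_
          by_cases h2 : Z n i ≤ C * (1 / 4) ^ n
          · rw [if_neg h2.not_gt, if_pos h2, zero_add]
          · rw [if_pos (lt_of_not_ge h2), if_neg h2, add_zero]
      _ = _ := by simp
  rw [Finset.sum_boole (fun i => Z n i ≤ _)] at h1
  linarith

end IsPolarTree

end PolarTree

/-! ### The recursion of the polar transform -/

section Recursion

/-- The position `2 k` of a word of length `2 ^ (ν + 1)`. -/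
def evenIdx {ν : ℕ} (k : Fin (2 ^ ν)) : Fin (2 ^ (ν + 1)) :=
  ⟨2 * k.1, by have := k.2; rw [pow_succ]; omega⟩

/-- The position `2 k + 1` of a word of length `2 ^ (ν + 1)`. -/
def oddIdx {ν : ℕ} (k : Fin (2 ^ ν)) : Fin (2 ^ (ν + 1)) :=
  ⟨2 * k.1 + 1, by have := k.2; rw [pow_succ]; omega⟩

theorem finCongr_finProdFinEquiv_zero {ν : ℕ} (k : Fin (2 ^ ν)) :
    finCongr (pow_succ 2 ν).symm (finProdFinEquiv (k, (0 : Fin 2))) = evenIdx k := by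
  ext
  simp [evenIdx]

theorem finCongr_finProdFinEquiv_one {ν : ℕ} (k : Fin (2 ^ ν)) :
    finCongr (pow_succ 2 ν).symm (finProdFinEquiv (k, (1 : Fin 2))) = oddIdx k := by
  ext
  simp [oddIdx, add_comm]

/-- The shuffle turns the interleaved input pairs into two output halves, so that `u G_{2N}` is the
concatenation of `a G_N` and `b G_N` for the two halves `a`, `b` of `splitWord`. -/
theorem polarTransform_succ_apply {ν : ℕ} (k l : Fin (2 ^ ν)) (c d : Fin 2) :
    polarTransform (ν + 1) (finCongr (pow_succ 2 ν).symm (finProdFinEquiv (k, c)))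
      (finCongr (pow_succ' 2 ν).symm (finProdFinEquiv (d, l))) =
    polarKernel c d * polarTransform ν k l := by
  simp only [polarTransform, Matrix.reindex_apply, Matrix.submatrix_apply, Equiv.symm_apply_apply,
    Matrix.mul_apply, reverseShuffleMatrix, Matrix.of_apply, Matrix.kroneckerMap_apply]
  have hs (g : Fin (2 ^ ν * 2) → ZMod 2) : ∑ j, g j = ∑ k, ∑ c, g (finProdFinEquiv (k, c)) := by
    rw [← finProdFinEquiv.sum_comp, Fintype.sum_prod_type]
  rw [← finProdFinEquiv.sum_comp, Fintype.sum_prod_type]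
  simp only [hs, Equiv.symm_apply_apply, reverseShuffle, Equiv.trans_apply, Equiv.prodComm_apply,
    Prod.swap_prod_mk, EmbeddingLike.apply_eq_iff_eq, Prod.mk.injEq, Matrix.one_apply]
  simp [ite_and]

/-- The bijection `u ↦ (a, b)` with `a_k = u_{2k} + u_{2k+1}` and `b_k = u_{2k+1}`. -/
def splitWord (ν : ℕ) : (Fin (2 ^ (ν + 1)) → ZMod 2) ≃
    (Fin (2 ^ ν) → ZMod 2) × (Fin (2 ^ ν) → ZMod 2) where
  toFun u := (fun k => u (evenIdx k) + u (oddIdx k), fun k => u (oddIdx k))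
  invFun w j :=
    have hj : j.1 / 2 < 2 ^ ν := by have := j.2; have := pow_succ 2 ν; omega
    if j.1 % 2 = 0 then w.1 ⟨j.1 / 2, hj⟩ + w.2 ⟨j.1 / 2, hj⟩ else w.2 ⟨j.1 / 2, hj⟩
  left_inv u := by
    ext j
    dsimp only
    split_ifs with h
    · have h0 : evenIdx ⟨j.1 / 2, by have := j.2; have := pow_succ 2 ν; omega⟩ = j := by
        ext; simp only [evenIdx]; omega
      rw [h0, add_assoc, CharTwo.add_self_eq_zero, add_zero]
    · congr 1
      ext; simp only [oddIdx]; omega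
  right_inv w := by
    have h1 (k : ℕ) : (2 * k + 1) / 2 = k := by omega
    ext k
    · simp [evenIdx, oddIdx, h1, add_assoc, CharTwo.add_self_eq_zero]
    · simp [oddIdx, h1]

theorem sum_fin_two_pow_succ {M : Type*} [AddCommMonoid M] {ν : ℕ} (g : Fin (2 ^ (ν + 1)) → M) :
    ∑ j, g j = ∑ k, (g (evenIdx k) + g (oddIdx k)) := by
  rw [← (finCongr (pow_succ 2 ν).symm).sum_comp, ← finProdFinEquiv.sum_comp,
    Fintype.sum_prod_type]
  simp only [Fin.sum_univ_two, finCongr_finProdFinEquiv_zero, finCongr_finProdFinEquiv_one]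

theorem vecMul_polarTransform_succ_zero {ν : ℕ} (u : Fin (2 ^ (ν + 1)) → ZMod 2)
    (l : Fin (2 ^ ν)) :
    Matrix.vecMul u (polarTransform (ν + 1))
      (finCongr (pow_succ' 2 ν).symm (finProdFinEquiv ((0 : Fin 2), l))) =
    Matrix.vecMul (splitWord ν u).1 (polarTransform ν) l := by
  simp only [Matrix.vecMul, dotProduct, sum_fin_two_pow_succ, splitWord, Equiv.coe_fn_mk]
  refine Finset.sum_congr rfl fun k _ => ?_
  rw [← finCongr_finProdFinEquiv_zero, ← finCongr_finProdFinEquiv_one, polarTransform_succ_apply,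
    polarTransform_succ_apply]
  simp [polarKernel, add_mul]

theorem vecMul_polarTransform_succ_one {ν : ℕ} (u : Fin (2 ^ (ν + 1)) → ZMod 2)
    (l : Fin (2 ^ ν)) :
    Matrix.vecMul u (polarTransform (ν + 1))
      (finCongr (pow_succ' 2 ν).symm (finProdFinEquiv ((1 : Fin 2), l))) =
    Matrix.vecMul (splitWord ν u).2 (polarTransform ν) l := by
  simp only [Matrix.vecMul, dotProduct, sum_fin_two_pow_succ, splitWord, Equiv.coe_fn_mk]
  refine Finset.sum_congr rfl fun k _ => ?_
  rw [← finCongr_finProdFinEquiv_zero, ← finCongr_finProdFinEquiv_one, polarTransform_succ_apply,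
    polarTransform_succ_apply]
  simp [polarKernel]

theorem vecMul_polarTransform_injective (ν : ℕ) :
    Function.Injective fun u => Matrix.vecMul u (polarTransform ν) := by
  induction ν with
  | zero => intro u v h; simpa [polarTransform] using h
  | succ ν ih =>
    intro u v h
    apply (splitWord ν).injective
    refine Prod.ext (ih (funext fun l => ?_)) (ih (funext fun l => ?_))
    · simp only [← vecMul_polarTransform_succ_zero]
      exact congrFun h _
    · simp only [← vecMul_polarTransform_succ_one]
      exact congrFun h _

/-- The polar transform as a bijection. -/
noncomputable def polarEquiv (ν : ℕ) : (Fin (2 ^ ν) → ZMod 2) ≃ (Fin (2 ^ ν) → ZMod 2) :=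
  Equiv.ofBijective (fun u => Matrix.vecMul u (polarTransform ν))
    (Finite.injective_iff_bijective.1 (vecMul_polarTransform_injective ν))

theorem polarEquiv_apply {ν : ℕ} (u : Fin (2 ^ ν) → ZMod 2) :
    polarEquiv ν u = Matrix.vecMul u (polarTransform ν) := rfl

/-- The probability of the word `u`, where `u G_N` has independent bits that equal `1` with
probability `p`. -/
def wordMass (p : ℝ) {ν : ℕ} (u : Fin (2 ^ ν) → ZMod 2) : ℝ :=
  ∏ j, bitMass p (Matrix.vecMul u (polarTransform ν) j)

theorem wordMass_succ (p : ℝ) {ν : ℕ} (u : Fin (2 ^ (ν + 1)) → ZMod 2) :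
    wordMass p u = wordMass p (splitWord ν u).1 * wordMass p (splitWord ν u).2 := by
  simp only [wordMass]
  rw [← (finCongr (pow_succ' 2 ν).symm).prod_comp, ← finProdFinEquiv.prod_comp,
    Fintype.prod_prod_type, Fin.prod_univ_two]
  simp only [vecMul_polarTransform_succ_zero, vecMul_polarTransform_succ_one]

theorem bitMass_nonneg {p : ℝ} (h0 : 0 ≤ p) (h1 : p ≤ 1) (b : ZMod 2) : 0 ≤ bitMass p b := by
  unfold bitMass
  split_ifs <;> linarith

theorem wordMass_nonneg {p : ℝ} (h0 : 0 ≤ p) (h1 : p ≤ 1) {ν : ℕ} (u : Fin (2 ^ ν) → ZMod 2) :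
    0 ≤ wordMass p u :=
  Finset.prod_nonneg fun _ _ => bitMass_nonneg h0 h1 _

theorem sum_prod_bitMass (p : ℝ) (N : ℕ) :
    ∑ x : Fin N → ZMod 2, ∏ j, bitMass p (x j) = 1 := by
  rw [← Fintype.prod_sum]
  simp [sum_zmod_two, bitMass]

theorem sum_wordMass (p : ℝ) (ν : ℕ) : ∑ u : Fin (2 ^ ν) → ZMod 2, wordMass p u = 1 := by
  rw [← sum_prod_bitMass p (2 ^ ν)]
  exact (polarEquiv ν).sum_comp fun x => ∏ j, bitMass p (x j)

theorem prefixMass_eq_sum_ite (p : ℝ) {ν : ℕ} (u : Fin (2 ^ ν) → ZMod 2) (i : Fin (2 ^ ν))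
    (b : ZMod 2) :
    prefixMass p u i b = ∑ w, if (∀ j < i, w j = u j) ∧ w i = b then wordMass p w else 0 := by
  rw [prefixMass, Finset.sum_filter]
  rfl

theorem prefixMass_nonneg {p : ℝ} (h0 : 0 ≤ p) (h1 : p ≤ 1) {ν : ℕ} (u : Fin (2 ^ ν) → ZMod 2)
    (i : Fin (2 ^ ν)) (b : ZMod 2) : 0 ≤ prefixMass p u i b :=
  Finset.sum_nonneg fun w _ => wordMass_nonneg h0 h1 w

theorem prefixMass_congr (p : ℝ) {ν : ℕ} {u v : Fin (2 ^ ν) → ZMod 2} {i : Fin (2 ^ ν)}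
    (h : ∀ j < i, u j = v j) (b : ZMod 2) : prefixMass p u i b = prefixMass p v i b := by
  rw [prefixMass_eq_sum_ite, prefixMass_eq_sum_ite]
  refine Finset.sum_congr rfl fun w _ => ?_
  congr 2
  exact propext (forall₂_congr fun j hj => by rw [h j hj])

/-! ### Prefix probabilities under the recursion. -/

theorem forall_lt_evenIdx {ν : ℕ} (w u : Fin (2 ^ (ν + 1)) → ZMod 2) (i : Fin (2 ^ ν)) :
    (∀ j < evenIdx i, w j = u j) ↔
      (∀ j < i, (splitWord ν w).1 j = (splitWord ν u).1 j) ∧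
        ∀ j < i, (splitWord ν w).2 j = (splitWord ν u).2 j := by
  have key : (∀ j < evenIdx i, w j = u j) ↔
      ∀ j < i, w (evenIdx j) = u (evenIdx j) ∧ w (oddIdx j) = u (oddIdx j) := by
    constructor
    · intro h j hj
      have : j.1 < i.1 := hj
      exact ⟨h _ (by show 2 * j.1 < 2 * i.1; omega), h _ (by show 2 * j.1 + 1 < 2 * i.1; omega)⟩
    · intro h j hj
      have h1 : j.1 < 2 * i.1 := hj
      have h2 := h ⟨j.1 / 2, by have := i.2; omega⟩ (by show j.1 / 2 < i.1; omega)
      rcases Nat.mod_two_eq_zero_or_one j.1 with h3 | h3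
      · convert h2.1 using 2 <;> (ext; simp only [evenIdx]; omega)
      · convert h2.2 using 2 <;> (ext; simp only [oddIdx]; omega)
  rw [key, ← forall₂_and]
  refine forall₂_congr fun j _ => ?_
  simp only [splitWord, Equiv.coe_fn_mk]
  constructor
  · rintro ⟨h1, h2⟩
    rw [h1, h2]
    exact ⟨rfl, rfl⟩
  · rintro ⟨h1, h2⟩
    rw [h2] at h1
    exact ⟨add_right_cancel h1, h2⟩

theorem forall_lt_oddIdx {ν : ℕ} (w u : Fin (2 ^ (ν + 1)) → ZMod 2) (i : Fin (2 ^ ν)) :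
    (∀ j < oddIdx i, w j = u j) ↔ (∀ j < evenIdx i, w j = u j) ∧ w (evenIdx i) = u (evenIdx i) := by
  constructor
  · intro h
    refine ⟨fun j hj => h j ?_, h _ ?_⟩
    · have : j.1 < 2 * i.1 := hj
      show j.1 < 2 * i.1 + 1
      omega
    · show 2 * i.1 < 2 * i.1 + 1
      omega
  · rintro ⟨h1, h2⟩ j hj
    have : j.1 < 2 * i.1 + 1 := hj
    rcases Nat.lt_succ_iff_lt_or_eq.1 this with h3 | h3
    · exact h1 j h3
    · have : j = evenIdx i := by ext; exact h3
      rw [this, h2]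

theorem splitWord_evenIdx {ν : ℕ} (w : Fin (2 ^ (ν + 1)) → ZMod 2) (i : Fin (2 ^ ν)) :
    w (evenIdx i) = (splitWord ν w).1 i + (splitWord ν w).2 i := by
  simp [splitWord, add_assoc, CharTwo.add_self_eq_zero]

theorem splitWord_oddIdx {ν : ℕ} (w : Fin (2 ^ (ν + 1)) → ZMod 2) (i : Fin (2 ^ ν)) :
    w (oddIdx i) = (splitWord ν w).2 i := rfl

theorem prefixMass_evenIdx (p : ℝ) {ν : ℕ} (u : Fin (2 ^ (ν + 1)) → ZMod 2) (i : Fin (2 ^ ν))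
    (c : ZMod 2) :
    prefixMass p u (evenIdx i) c =
      prefixMass p (splitWord ν u).1 i c * prefixMass p (splitWord ν u).2 i 0 +
      prefixMass p (splitWord ν u).1 i (c + 1) * prefixMass p (splitWord ν u).2 i 1 := by
  simp only [prefixMass_eq_sum_ite, forall_lt_evenIdx, splitWord_evenIdx, wordMass_succ]
  rw [(splitWord ν).sum_comp (fun w => if ((∀ j < i, w.1 j = (splitWord ν u).1 j) ∧
    ∀ j < i, w.2 j = (splitWord ν u).2 j) ∧ w.1 i + w.2 i = c then
      wordMass p w.1 * wordMass p w.2 else 0), Fintype.sum_prod_type]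
  simp only [Finset.sum_mul_sum, ← Finset.sum_add_distrib]
  refine Finset.sum_congr rfl fun a _ => Finset.sum_congr rfl fun b _ => ?_
  have hb : b i = 0 ∨ b i = 1 := by generalize b i = x; revert x; decide
  have hc : a i + 1 = c ↔ a i = c + 1 := by
    generalize a i = x; revert x c; decide
  by_cases h1 : ∀ j < i, a j = (splitWord ν u).1 j
  · by_cases h2 : ∀ j < i, b j = (splitWord ν u).2 j
    · rcases hb with hb | hb <;> simp [eq_true h1, eq_true h2, hb, hc]
    · simp [h2]
  · simp [h1]

theorem prefixMass_oddIdx (p : ℝ) {ν : ℕ} (u : Fin (2 ^ (ν + 1)) → ZMod 2) (i : Fin (2 ^ ν))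
    (c : ZMod 2) :
    prefixMass p u (oddIdx i) c =
      prefixMass p (splitWord ν u).1 i ((splitWord ν u).1 i + (splitWord ν u).2 i + c) *
        prefixMass p (splitWord ν u).2 i c := by
  simp only [prefixMass_eq_sum_ite, forall_lt_oddIdx, forall_lt_evenIdx, splitWord_evenIdx,
    wordMass_succ, splitWord_oddIdx]
  rw [(splitWord ν).sum_comp (fun w => if (((∀ j < i, w.1 j = (splitWord ν u).1 j) ∧
    ∀ j < i, w.2 j = (splitWord ν u).2 j) ∧ w.1 i + w.2 i =
      (splitWord ν u).1 i + (splitWord ν u).2 i) ∧ w.2 i = c then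
      wordMass p w.1 * wordMass p w.2 else 0), Fintype.sum_prod_type]
  simp only [Finset.sum_mul_sum]
  refine Finset.sum_congr rfl fun a _ => Finset.sum_congr rfl fun b _ => ?_
  have hc : ∀ s : ZMod 2, a i + c = s ↔ a i = s + c := by
    generalize a i = x; revert x c; decide
  by_cases h1 : ∀ j < i, a j = (splitWord ν u).1 j
  · by_cases h2 : ∀ j < i, b j = (splitWord ν u).2 j
    · by_cases hb : b i = c
      · simp [eq_true h1, eq_true h2, hb, hc]
      · simp [hb]
    · simp [h2]
  · simp [h1]

/-- The source whose bit is `U_i` and whose side information is a word that is uniform given its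
first `i` bits `U₁^{i-1}`. -/
noncomputable def polarSource (p : ℝ) {ν : ℕ} (i : Fin (2 ^ ν)) (u : Fin (2 ^ ν) → ZMod 2)
    (b : ZMod 2) : ℝ :=
  (1 / 2 : ℝ) ^ (2 ^ ν - i.1) * prefixMass p u i b

/-- This count of free bits is cancelled by the weight in `polarSource`, which lets full words serve
as side information in place of prefixes. -/
theorem card_filter_eq_below {ν : ℕ} (i : Fin (2 ^ ν)) (w : Fin (2 ^ ν) → ZMod 2) :
    (Finset.univ.filter fun u : Fin (2 ^ ν) → ZMod 2 => ∀ j < i, w j = u j).card =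
      2 ^ (2 ^ ν - i.1) := by
  have h : (Finset.univ.filter fun u : Fin (2 ^ ν) → ZMod 2 => ∀ j < i, w j = u j) =
      Fintype.piFinset fun j => if j < i then {w j} else Finset.univ := by
    ext u
    simp only [Finset.mem_filter, Finset.mem_univ, true_and, Fintype.mem_piFinset]
    refine forall_congr' fun j => ?_
    split_ifs with hj <;> simp [hj, eq_comm]
  rw [h, Fintype.card_piFinset]
  have h2 : ∀ j, (if j < i then ({w j} : Finset (ZMod 2)) else Finset.univ).card =
      if j < i then 1 else 2 := by
    intro j
    split_ifs
    · simp
    · rfl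
  simp only [h2]
  rw [Finset.prod_ite, Finset.prod_const_one, one_mul, Finset.prod_const]
  congr 1
  have : (Finset.univ.filter fun j => ¬ j < i) = Finset.Ici i := by ext; simp
  rw [this, Fin.card_Ici]

/-- Summation of a function of the first `i + 1` bits against the source. -/
theorem sum_polarSource_mul (p : ℝ) {ν : ℕ} (i : Fin (2 ^ ν))
    (g : (Fin (2 ^ ν) → ZMod 2) → ZMod 2 → ℝ)
    (hg : ∀ u v b, (∀ j < i, u j = v j) → g u b = g v b) :
    ∑ u, ∑ b, polarSource p i u b * g u b = ∑ w, wordMass p w * g w (w i) := by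
  calc _ = ∑ u : Fin (2 ^ ν) → ZMod 2, ∑ w : Fin (2 ^ ν) → ZMod 2, (1 / 2 : ℝ) ^ (2 ^ ν - i.1) *
        (if ∀ j < i, w j = u j then wordMass p w * g w (w i) else 0) := by
        refine Finset.sum_congr rfl fun u _ => ?_
        simp only [polarSource, prefixMass_eq_sum_ite, mul_assoc, Finset.sum_mul,
          ← Finset.mul_sum]
        congr 1
        rw [Finset.sum_comm]
        refine Finset.sum_congr rfl fun w _ => ?_
        split_ifs with h
        · simp [eq_true h, hg w u _ h]
        · simp [h]
    _ = ∑ w : Fin (2 ^ ν) → ZMod 2, (wordMass p w * g w (w i)) * ((1 / 2 : ℝ) ^ (2 ^ ν - i.1) *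
        (Finset.univ.filter fun u : Fin (2 ^ ν) → ZMod 2 => ∀ j < i, w j = u j).card) := by
        rw [Finset.sum_comm]
        refine Finset.sum_congr rfl fun w _ => ?_
        rw [← Finset.mul_sum, ← Finset.sum_filter, Finset.sum_const, nsmul_eq_mul]
        ring
    _ = _ := by
        refine Finset.sum_congr rfl fun w _ => ?_
        rw [card_filter_eq_below]
        push_cast
        rw [← mul_pow]
        norm_num

theorem isSource_polarSource {p : ℝ} (h0 : 0 ≤ p) (h1 : p ≤ 1) {ν : ℕ} (i : Fin (2 ^ ν)) :
    IsSource (polarSource p i) where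
  nonneg u b := mul_nonneg (by positivity) (prefixMass_nonneg h0 h1 u i b)
  sum_eq_one := by
    have h := sum_polarSource_mul p i (fun _ _ => 1) fun _ _ _ _ => rfl
    simpa [sum_zmod_two, sum_wordMass] using h

theorem polarSource_evenIdx (p : ℝ) {ν : ℕ} (i : Fin (2 ^ ν)) (u : Fin (2 ^ (ν + 1)) → ZMod 2) :
    polarSource p (evenIdx i) u = minusSource (polarSource p i) (splitWord ν u) := by
  funext c
  have h : 2 ^ (ν + 1) - (evenIdx i).1 = (2 ^ ν - i.1) + (2 ^ ν - i.1) := by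
    simp only [evenIdx, pow_succ]; omega
  have h2 : (1 / 2 : ℝ) ^ (2 ^ (ν + 1) - (evenIdx i).1) =
      (1 / 2) ^ (2 ^ ν - i.1) * (1 / 2) ^ (2 ^ ν - i.1) := by
    rw [h, pow_add]
  simp only [polarSource, minusSource, prefixMass_evenIdx, h2]
  ring

/-- The factor `2` arises because the sum bit, a separate component in the plus source, is already
contained in the word `u`. -/
theorem polarSource_oddIdx (p : ℝ) {ν : ℕ} (i : Fin (2 ^ ν)) (u : Fin (2 ^ (ν + 1)) → ZMod 2)
    (c : ZMod 2) :
    polarSource p (oddIdx i) u c = 2 * plusSource (polarSource p i)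
      (splitWord ν u, (splitWord ν u).1 i + (splitWord ν u).2 i) c := by
  have h : 2 ^ (ν + 1) - (oddIdx i).1 + 1 = (2 ^ ν - i.1) + (2 ^ ν - i.1) := by
    have := i.2
    simp only [oddIdx, pow_succ]; omega
  have h2 : (1 / 2 : ℝ) ^ (2 ^ (ν + 1) - (oddIdx i).1) =
      2 * ((1 / 2) ^ (2 ^ ν - i.1) * (1 / 2) ^ (2 ^ ν - i.1)) := by
    rw [← pow_add, ← h, pow_succ (1 / 2 : ℝ)]
    ring
  simp only [polarSource, plusSource, prefixMass_oddIdx, h2]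
  ring

theorem condEntropy_polarSource_evenIdx (p : ℝ) {ν : ℕ} (i : Fin (2 ^ ν)) :
    condEntropy (polarSource p (evenIdx i)) = condEntropy (minusSource (polarSource p i)) := by
  simp only [condEntropy, polarSource_evenIdx]
  exact (splitWord ν).sum_comp fun w => bitEntropy (minusSource (polarSource p i) w 0)
    (minusSource (polarSource p i) w 1)

theorem bhattacharyya_polarSource_evenIdx (p : ℝ) {ν : ℕ} (i : Fin (2 ^ ν)) :
    bhattacharyya (polarSource p (evenIdx i)) = bhattacharyya (minusSource (polarSource p i)) := by
  simp only [bhattacharyya, polarSource_evenIdx]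
  exact (splitWord ν).sum_comp fun w => 2 * √(minusSource (polarSource p i) w 0 *
    minusSource (polarSource p i) w 1)

theorem polarSource_congr (p : ℝ) {ν : ℕ} {u v : Fin (2 ^ ν) → ZMod 2} {i : Fin (2 ^ ν)}
    (h : ∀ j < i, u j = v j) : polarSource p i u = polarSource p i v := by
  funext b
  rw [polarSource, polarSource, prefixMass_congr p h]

/-- Replacing the sum over the known bit of the plus source by twice its value at one word. -/
theorem sum_plusSource_polarSource (p : ℝ) {ν : ℕ} (i : Fin (2 ^ ν)) (F : ℝ → ℝ → ℝ) :
    ∑ y, F (plusSource (polarSource p i) y 0) (plusSource (polarSource p i) y 1) =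
      ∑ u : Fin (2 ^ (ν + 1)) → ZMod 2, 2 *
        F (plusSource (polarSource p i) (splitWord ν u, (splitWord ν u).1 i + (splitWord ν u).2 i) 0)
          (plusSource (polarSource p i)
            (splitWord ν u, (splitWord ν u).1 i + (splitWord ν u).2 i) 1) := by
  rw [(splitWord ν).sum_comp fun w => 2 *
        F (plusSource (polarSource p i) (w, w.1 i + w.2 i) 0)
          (plusSource (polarSource p i) (w, w.1 i + w.2 i) 1)]
  rw [Fintype.sum_prod_type, Fintype.sum_prod_type, Fintype.sum_prod_type, Finset.sum_comm]
  conv_rhs => rw [Finset.sum_comm]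
  refine Finset.sum_congr rfl fun b _ => ?_
  set g : (Fin (2 ^ ν) → ZMod 2) → ZMod 2 → ℝ := fun a c =>
    F (plusSource (polarSource p i) ((a, b), c) 0) (plusSource (polarSource p i) ((a, b), c) 1)
    with hg
  -- Flipping `a i` changes `a i + b i` but not the source, which only sees bits before `i`; hence
  -- both values of the known bit contribute equally.
  have hflip : ∑ a : Fin (2 ^ ν) → ZMod 2, g a (a i + b i) =
      ∑ a : Fin (2 ^ ν) → ZMod 2, g a (a i + b i + 1) := by
    rw [← Equiv.sum_comp (Equiv.addRight (Pi.single i 1 : Fin (2 ^ ν) → ZMod 2))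
      fun a => g a (a i + b i)]
    refine Finset.sum_congr rfl fun a _ => ?_
    have h1 : polarSource p i (a + Pi.single i 1) = polarSource p i a :=
      polarSource_congr p fun j hj => by simp [hj.ne]
    simp only [hg, plusSource, Equiv.coe_addRight, h1, Pi.add_apply, Pi.single_eq_same,
      add_right_comm (a i) 1 (b i)]
  calc _ = ∑ a : Fin (2 ^ ν) → ZMod 2, (g a (a i + b i) + g a (a i + b i + 1)) := by
        refine Finset.sum_congr rfl fun a _ => ?_
        rw [sum_zmod_two]
        have hb : a i + b i = 0 ∨ a i + b i = 1 := by
          generalize a i + b i = x; revert x; decide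
        rcases hb with hb | hb
        · rw [hb, zero_add]
        · rw [hb, one_add_one_zmod_two, add_comm]
    _ = _ := by
        rw [Finset.sum_add_distrib, ← hflip, ← Finset.mul_sum, two_mul]

theorem condEntropy_polarSource_oddIdx (p : ℝ) {ν : ℕ} (i : Fin (2 ^ ν)) :
    condEntropy (polarSource p (oddIdx i)) = condEntropy (plusSource (polarSource p i)) := by
  simp only [condEntropy, polarSource_oddIdx, bitEntropy_mul]
  exact (sum_plusSource_polarSource p i bitEntropy).symm

theorem bhattacharyya_polarSource_oddIdx (p : ℝ) {ν : ℕ} (i : Fin (2 ^ ν)) :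
    bhattacharyya (polarSource p (oddIdx i)) = bhattacharyya (plusSource (polarSource p i)) := by
  simp only [bhattacharyya, polarSource_oddIdx]
  rw [sum_plusSource_polarSource p i fun a b => 2 * √(a * b)]
  refine Finset.sum_congr rfl fun u _ => ?_
  rw [mul_mul_mul_comm, Real.sqrt_mul (by norm_num), Real.sqrt_mul_self (by norm_num)]

/-- The Bhattacharyya parameter of the `i`-th source at level `n`. -/
noncomputable def levelBhattacharyya (p : ℝ) (n i : ℕ) : ℝ :=
  if h : i < 2 ^ n then bhattacharyya (polarSource p (⟨i, h⟩ : Fin (2 ^ n))) else 0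

/-- The conditional entropy of the `i`-th source at level `n`. -/
noncomputable def levelEntropy (p : ℝ) (n i : ℕ) : ℝ :=
  if h : i < 2 ^ n then condEntropy (polarSource p (⟨i, h⟩ : Fin (2 ^ n))) else 0

/-- Indices beyond the level carry the value zero, for which the recursion is trivial. -/
theorem isPolarTree_level {p : ℝ} (h0 : 0 ≤ p) (h1 : p ≤ 1) :
    IsPolarTree (levelBhattacharyya p) (levelEntropy p) where
  nonneg n i := by
    unfold levelBhattacharyya
    split_ifs
    · exact IsSource.bhattacharyya_nonneg _
    · exact le_rfl
  le_one n i := by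
    unfold levelBhattacharyya
    split_ifs
    · exact (isSource_polarSource h0 h1 _).bhattacharyya_le_one
    · exact zero_le_one
  minus_le n i := by
    unfold levelBhattacharyya
    by_cases h : i < 2 ^ n
    · rw [dif_pos h, dif_pos (by rw [pow_succ]; omega)]
      exact (bhattacharyya_polarSource_evenIdx p ⟨i, h⟩).le.trans
        (isSource_polarSource h0 h1 _).bhattacharyya_minusSource_le
    · rw [dif_neg h, dif_neg (by rw [pow_succ]; omega)]
      norm_num
  plus_le n i := by
    unfold levelBhattacharyya
    by_cases h : i < 2 ^ n
    · rw [dif_pos h, dif_pos (by rw [pow_succ]; omega)]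
      exact ((bhattacharyya_polarSource_oddIdx p ⟨i, h⟩).trans
        (isSource_polarSource h0 h1 _).bhattacharyya_plusSource).le
    · rw [dif_neg h, dif_neg (by rw [pow_succ]; omega)]
      norm_num
  entropy_nonneg n i := by
    unfold levelEntropy
    split_ifs
    · exact (isSource_polarSource h0 h1 _).condEntropy_nonneg
    · exact le_rfl
  entropy_add n i := by
    unfold levelEntropy
    by_cases h : i < 2 ^ n
    · rw [dif_pos h, dif_pos (by rw [pow_succ]; omega), dif_pos (by rw [pow_succ]; omega),
        ← (isSource_polarSource h0 h1 _).condEntropy_minusSource_add_condEntropy_plusSource,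
        ← condEntropy_polarSource_evenIdx, ← condEntropy_polarSource_oddIdx]
      rfl
    · rw [dif_neg h, dif_neg (by rw [pow_succ]; omega), dif_neg (by rw [pow_succ]; omega)]
      norm_num
  le_entropy n i h := by
    rw [levelBhattacharyya, levelEntropy, dif_pos h, dif_pos h]
    exact (isSource_polarSource h0 h1 _).le_condEntropy

end Recursion

/-! ### Capacities of the effective channels -/

section Capacity

open Real

theorem half_mul_logb_add (a b : ℝ) (ha : 0 ≤ a) (hb : 0 ≤ b) :
    1 / 2 * a * logb 2 (a / (1 / 2 * a + 1 / 2 * b)) +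
      1 / 2 * b * logb 2 (b / (1 / 2 * a + 1 / 2 * b)) =
    1 / 2 * (a + b) - bitEntropy a b / (2 * log 2) := by
  have hl : log 2 ≠ 0 := (log_pos (by norm_num)).ne'
  have h1 : ∀ x : ℝ, 0 < x → x / (1 / 2 * x) = 2 := fun x hx => by field_simp
  rcases ha.eq_or_lt with rfl | ha
  · rcases hb.eq_or_lt with rfl | hb
    · simp [bitEntropy_zero_left]
    · simp only [bitEntropy_zero_left, mul_zero, zero_mul, zero_add, h1 b hb]
      rw [logb_self_eq_one (by norm_num)]
      ring
  rcases hb.eq_or_lt with rfl | hb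
  · simp only [bitEntropy_zero_right, mul_zero, zero_mul, add_zero, h1 a ha]
    rw [logb_self_eq_one (by norm_num)]
    ring
  have hab : a + b ≠ 0 := by positivity
  have h2 : ∀ x : ℝ, 0 < x → logb 2 (x / (1 / 2 * a + 1 / 2 * b)) =
      1 + log (x / (a + b)) / log 2 := by
    intro x hx
    rw [show x / (1 / 2 * a + 1 / 2 * b) = 2 * (x / (a + b)) by field_simp, logb,
      log_mul two_ne_zero (by positivity), add_div, div_self hl]
  rw [h2 a ha, h2 b hb, bitEntropy_eq_log_div ha hb]
  field_simp
  ring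

theorem capacity_eq {Y : Type*} [Fintype Y] (W : ZMod 2 → Y → ℝ) (hW : ∀ b y, 0 ≤ W b y) :
    capacity W = 1 / 2 * ∑ y, (W 0 y + W 1 y) -
      (∑ y, bitEntropy (W 0 y) (W 1 y)) / (2 * log 2) := by
  simp only [capacity, sum_zmod_two, half_mul_logb_add _ _ (hW 0 _) (hW 1 _)]
  rw [Finset.sum_sub_distrib, Finset.mul_sum, Finset.sum_div]

/-- The word that starts with `v`, padded by zeros. -/
def padWord {ν : ℕ} {i : Fin (2 ^ ν)} (v : {j : Fin (2 ^ ν) // j < i} → ZMod 2)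
    (j : Fin (2 ^ ν)) : ZMod 2 :=
  if h : j < i then v ⟨j, h⟩ else 0

/-- The noise is additive: for output `x G_N` and input `u G_N` it is `(x - u) G_N`, so the sum over
`u` is a sum over error words `x - u`. -/
theorem effectiveChannel_polarEquiv (p : ℝ) {ν : ℕ} (i : Fin (2 ^ ν)) (b : ZMod 2)
    (x : Fin (2 ^ ν) → ZMod 2) (v : {j : Fin (2 ^ ν) // j < i} → ZMod 2) :
    effectiveChannel p i b (polarEquiv ν x, v) =
      (1 / 2) ^ (2 ^ ν - 1) * prefixMass p (x - padWord v) i (x i - b) := by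
  rw [effectiveChannel, prefixMass_eq_sum_ite, Finset.sum_filter]
  congr 1
  rw [← (Equiv.subLeft x).sum_comp]
  refine Finset.sum_congr rfl fun w _ => ?_
  have h1 : ((∀ j : {j // j < i}, Equiv.subLeft x w j.1 = v j) ∧ Equiv.subLeft x w i = b) ↔
      ((∀ j < i, w j = (x - padWord v) j) ∧ w i = x i - b) := by
    refine and_congr ?_ ?_
    · rw [Subtype.forall]
      refine forall₂_congr fun j hj => ?_
      simp only [Equiv.subLeft_apply, Pi.sub_apply, padWord, hj, dif_pos]
      rw [sub_eq_iff_eq_add, eq_sub_iff_add_eq, eq_comm, add_comm]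
    · simp only [Equiv.subLeft_apply, Pi.sub_apply]
      rw [sub_eq_iff_eq_add, eq_sub_iff_add_eq, eq_comm, add_comm]
  refine if_congr h1 (Finset.prod_congr rfl fun j _ => ?_) rfl
  rw [bsc, polarEquiv_apply, Equiv.subLeft_apply, Matrix.sub_vecMul, Pi.sub_apply, sub_sub_cancel]

theorem effectiveChannel_nonneg {p : ℝ} (h0 : 0 ≤ p) (h1 : p ≤ 1) {ν : ℕ} (i : Fin (2 ^ ν))
    (b : ZMod 2) (o : (Fin (2 ^ ν) → ZMod 2) × ({j : Fin (2 ^ ν) // j < i} → ZMod 2)) :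
    0 ≤ effectiveChannel p i b o :=
  mul_nonneg (by positivity) (Finset.sum_nonneg fun _ _ =>
    Finset.prod_nonneg fun _ _ => bitMass_nonneg h0 h1 _)

theorem card_prefixes {ν : ℕ} (i : Fin (2 ^ ν)) :
    Fintype.card ({j : Fin (2 ^ ν) // j < i} → ZMod 2) = 2 ^ i.1 := by
  have h : (Finset.univ.filter fun j : Fin (2 ^ ν) => j < i) = Finset.Iio i := by ext; simp
  rw [Fintype.card_fun, ZMod.card, Fintype.card_subtype, h, Fin.card_Iio]

/-- Shifting by the known prefix reduces every prefix to the same sum, and there are `2 ^ i`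
prefixes. Symmetry of `F` absorbs the swap of inputs when `x i = 1`, and homogeneity the
normalizations. -/
theorem sum_effectiveChannel (p : ℝ) {ν : ℕ} (i : Fin (2 ^ ν)) (F : ℝ → ℝ → ℝ)
    (hcomm : ∀ a b, F a b = F b a) (hmul : ∀ c a b, F (c * a) (c * b) = c * F a b) :
    ∑ o, F (effectiveChannel p i 0 o) (effectiveChannel p i 1 o) =
      2 * ∑ u, F (polarSource p i u 0) (polarSource p i u 1) := by
  have h1 : ∀ (x : Fin (2 ^ ν) → ZMod 2) (v : {j : Fin (2 ^ ν) // j < i} → ZMod 2),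
      F (effectiveChannel p i 0 (polarEquiv ν x, v)) (effectiveChannel p i 1 (polarEquiv ν x, v)) =
      (1 / 2) ^ (2 ^ ν - 1) * F (prefixMass p (x - padWord v) i 0)
        (prefixMass p (x - padWord v) i 1) := by
    intro x v
    rw [effectiveChannel_polarEquiv, effectiveChannel_polarEquiv, hmul]
    have hx : x i = 0 ∨ x i = 1 := by generalize x i = y; revert y; decide
    rcases hx with hx | hx
    · rw [hx, sub_zero, show (0 : ZMod 2) - 1 = 1 from rfl]
    · rw [hx, sub_zero, sub_self, hcomm]
  rw [Fintype.sum_prod_type, ← (polarEquiv ν).sum_comp]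
  simp only [h1, polarSource, hmul, ← Finset.mul_sum]
  rw [Finset.sum_comm]
  have h2 : ∀ v : {j : Fin (2 ^ ν) // j < i} → ZMod 2,
      ∑ x : Fin (2 ^ ν) → ZMod 2, F (prefixMass p (x - padWord v) i 0)
        (prefixMass p (x - padWord v) i 1) =
      ∑ x : Fin (2 ^ ν) → ZMod 2, F (prefixMass p x i 0) (prefixMass p x i 1) := fun v =>
    Equiv.sum_comp (Equiv.subRight (padWord v))
      fun x => F (prefixMass p x i 0) (prefixMass p x i 1)
  simp only [h2, Finset.sum_const, Finset.card_univ, card_prefixes, nsmul_eq_mul]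
  have h3 : (1 / 2 : ℝ) ^ (2 ^ ν - 1) * (2 ^ i.1 : ℕ) = 2 * (1 / 2) ^ (2 ^ ν - i.1) := by
    obtain ⟨k, hk⟩ := Nat.exists_eq_add_of_lt i.2
    have e1 : 2 ^ ν - 1 = i.1 + k := by omega
    have e2 : 2 ^ ν - i.1 = k + 1 := by omega
    rw [e1, e2, pow_add, pow_succ]
    push_cast
    rw [show (1 / 2 : ℝ) ^ i.1 * (1 / 2) ^ k * 2 ^ i.1 = (1 / 2 * 2) ^ i.1 * (1 / 2) ^ k by
      rw [mul_pow]; ring]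
    norm_num
    ring
  rw [← mul_assoc, h3, mul_assoc]

theorem capacity_effectiveChannel {p : ℝ} (h0 : 0 ≤ p) (h1 : p ≤ 1) {ν : ℕ} (i : Fin (2 ^ ν)) :
    capacity (effectiveChannel p i) = 1 - condEntropy (polarSource p i) / log 2 := by
  rw [capacity_eq _ (effectiveChannel_nonneg h0 h1 i),
    sum_effectiveChannel p i bitEntropy bitEntropy_comm bitEntropy_mul,
    sum_effectiveChannel p i (fun a b => a + b) add_comm (fun c a b => (mul_add c a b).symm),
    (isSource_polarSource h0 h1 i).sum_eq_one, condEntropy]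
  rw [mul_div_mul_left _ _ two_ne_zero]
  norm_num

end Capacity

/-! ### Error probability of the syndrome decoder -/

section Decoder

/-- The bit `u_i` is not strictly more likely than its complement, given the bits before it. -/
def IsAmbiguous (p : ℝ) {ν : ℕ} (i : Fin (2 ^ ν)) (u : Fin (2 ^ ν) → ZMod 2) (b : ZMod 2) : Prop :=
  prefixMass p u i b ≤ prefixMass p u i (b + 1)

-- Given the prefix, the ambiguous mass is the smaller of the two, or both of them in a tie, hence
-- at most twice the minimum.
open Classical in
theorem sum_wordMass_isAmbiguous_le {p : ℝ} (h0 : 0 ≤ p) (h1 : p ≤ 1) {ν : ℕ} (i : Fin (2 ^ ν)) :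
    (∑ w, if IsAmbiguous p i w (w i) then wordMass p w else 0) ≤
      2 * condEntropy (polarSource p i) := by
  have hS := isSource_polarSource h0 h1 i
  have h := sum_polarSource_mul p i (fun u b => if IsAmbiguous p i u b then 1 else 0)
    fun u v b huv => if_congr
      (by rw [IsAmbiguous, IsAmbiguous, prefixMass_congr p huv, prefixMass_congr p huv]) rfl rfl
  simp only [mul_ite, mul_one, mul_zero] at h
  rw [← h]
  refine le_trans ?_ (mul_le_mul_of_nonneg_left hS.sum_min_le_condEntropy zero_le_two)
  rw [Finset.mul_sum]
  refine Finset.sum_le_sum fun u _ => ?_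
  have hiff : ∀ b, IsAmbiguous p i u b ↔ polarSource p i u b ≤ polarSource p i u (b + 1) := by
    intro b
    rw [IsAmbiguous, polarSource, polarSource, mul_le_mul_iff_right₀ (by positivity)]
  simp only [sum_zmod_two, hiff, zero_add, one_add_one_zmod_two]
  have ha := hS.nonneg u 0
  have hb := hS.nonneg u 1
  rcases lt_trichotomy (polarSource p i u 0) (polarSource p i u 1) with h | h | h
  · rw [if_pos h.le, if_neg h.not_ge, min_eq_left h.le]
    linarith
  · rw [if_pos h.le, if_pos h.ge, min_eq_left h.le]
    linarith
  · rw [if_neg h.not_ge, if_pos h.le, min_eq_right h.le]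
    linarith

/-- Decode the syndrome of `w` itself. If each true information bit is strictly more likely than its
complement, the decoder reproduces `w` bit by bit, however ties are broken. -/
theorem exists_isAmbiguous {p : ℝ} {ν : ℕ} {A : Finset (Fin (2 ^ ν))}
    {f : ({j : Fin (2 ^ ν) // j ∉ A} → ZMod 2) → (Fin (2 ^ ν) → ZMod 2)}
    (hf : IsPolarSyndromeDecoder p A f) (w : Fin (2 ^ ν) → ZMod 2)
    (hw : polarEquiv ν w ∉ Finset.univ.image f) : ∃ i ∈ A, IsAmbiguous p i w (w i) := by
  by_contra! hc
  obtain ⟨u, hs, hmax, hu⟩ := hf fun j => w j.1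
  have huw : ∀ j, u j = w j := by
    intro j
    induction j using WellFoundedLT.induction with
    | ind j ih =>
      by_cases hj : j ∈ A
      · by_contra hne
        have h1 : u j = w j + 1 := by
          revert hne
          generalize u j = a
          generalize w j = b
          revert a b
          decide
        have h2 := hmax j hj (w j)
        rw [prefixMass_congr p ih, prefixMass_congr p ih, h1] at h2
        exact hc j hj h2
      · exact hs ⟨j, hj⟩
  rw [funext huw] at hu
  exact hw (Finset.mem_image.2 ⟨_, Finset.mem_univ _, hu⟩)

theorem sum_compl_range_le {p : ℝ} (h0 : 0 ≤ p) (h1 : p ≤ 1) {ν : ℕ} {A : Finset (Fin (2 ^ ν))}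
    {f : ({j : Fin (2 ^ ν) // j ∉ A} → ZMod 2) → (Fin (2 ^ ν) → ZMod 2)}
    (hf : IsPolarSyndromeDecoder p A f) :
    ∑ x ∈ (Finset.univ.image f)ᶜ, ∏ j, bitMass p (x j) ≤
      ∑ i ∈ A, 2 * condEntropy (polarSource p i) := by
  classical
  refine le_trans ?_ (Finset.sum_le_sum fun i _ => sum_wordMass_isAmbiguous_le h0 h1 i)
  have hT : (Finset.univ.image f)ᶜ = Finset.univ.filter (· ∉ Finset.univ.image f) := by
    ext
    simp
  rw [Finset.sum_comm, hT, Finset.sum_filter, ← (polarEquiv ν).sum_comp]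
  refine Finset.sum_le_sum fun w _ => ?_
  have hnn : ∀ i ∈ A, 0 ≤ if IsAmbiguous p i w (w i) then wordMass p w else 0 := fun i _ => by
    split_ifs
    · exact wordMass_nonneg h0 h1 w
    · exact le_rfl
  by_cases hw : polarEquiv ν w ∉ Finset.univ.image f
  · rw [if_pos hw]
    obtain ⟨i, hi, hiw⟩ := exists_isAmbiguous hf w hw
    refine le_trans ?_ (Finset.single_le_sum hnn hi)
    rw [if_pos hiw]
    exact le_rfl
  · rw [if_neg hw]
    exact Finset.sum_nonneg hnn

end Decoder

/-! ### The source state -/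

section SourceState

theorem tensorPower_mul (M M' : Matrix (ZMod 2) (ZMod 2) ℂ) (N : ℕ) :
    tensorPower M N * tensorPower M' N = tensorPower (M * M') N := by
  ext x y
  simp only [tensorPower, Matrix.mul_apply, Matrix.of_apply, Fintype.prod_sum,
    Finset.prod_mul_distrib]

theorem conjTranspose_tensorPower (M : Matrix (ZMod 2) (ZMod 2) ℂ) (N : ℕ) :
    (tensorPower M N).conjTranspose = tensorPower M.conjTranspose N := by
  ext x y
  simp [tensorPower, Matrix.conjTranspose_apply]

theorem tensorPower_diagonalQubit_diag (p : ℝ) (N : ℕ) (x : Fin N → ZMod 2) :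
    tensorPower (diagonalQubit p) N x x = ((∏ j, bitMass p (x j) : ℝ) : ℂ) := by
  simp [tensorPower, diagonalQubit]

theorem failureProbability_eq {ρ U : Matrix (ZMod 2) (ZMod 2) ℂ} {p : ℝ}
    (hp : U * ρ * U.conjTranspose = diagonalQubit p) {ν : ℕ} {A : Finset (Fin (2 ^ ν))}
    (f : ({j : Fin (2 ^ ν) // j ∉ A} → ZMod 2) → (Fin (2 ^ ν) → ZMod 2)) :
    failureProbability ρ U f =
      ((∑ x ∈ (Finset.univ.image f)ᶜ, ∏ j, bitMass p (x j) : ℝ) : ℂ) := by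
  have h := Finset.sum_add_sum_compl (Finset.univ.image f)
    fun x : Fin (2 ^ ν) → ZMod 2 => ∏ j, bitMass p (x j)
  rw [sum_prod_bitMass] at h
  rw [failureProbability, conjTranspose_tensorPower, tensorPower_mul, tensorPower_mul, hp,
    correctableProjector, Finset.sum_mul, Matrix.trace_sum]
  simp only [Matrix.trace_single_mul, one_smul, tensorPower_diagonalQubit_diag]
  rw [eq_sub_of_add_eq' h]
  push_cast
  rfl

/-- Trace and determinant determine the two eigenvalues up to order. -/
theorem eigenvalues_eq {ρ U : Matrix (ZMod 2) (ZMod 2) ℂ} (hρ : IsDensityMatrix ρ)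
    (hU : U ∈ Matrix.unitaryGroup (ZMod 2) ℂ) {p : ℝ}
    (hp : U * ρ * U.conjTranspose = diagonalQubit p) :
    (hρ.posSemidef.isHermitian.eigenvalues 0 = p ∧
      hρ.posSemidef.isHermitian.eigenvalues 1 = 1 - p) ∨
    (hρ.posSemidef.isHermitian.eigenvalues 0 = 1 - p ∧
      hρ.posSemidef.isHermitian.eigenvalues 1 = p) := by
  set hH := hρ.posSemidef.isHermitian
  have htr := hH.trace_eq_sum_eigenvalues
  rw [hρ.trace_eq_one] at htr
  have hsum := htr.trans (Fin.sum_univ_two fun b : ZMod 2 => (hH.eigenvalues b : ℂ))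
  have hdet := hH.det_eq_prod_eigenvalues
  have hUdet : U.det * U.conjTranspose.det = 1 := by
    rw [← Matrix.det_mul, ← Matrix.star_eq_conjTranspose, Matrix.mem_unitaryGroup_iff.1 hU,
      Matrix.det_one]
  have hd : ρ.det = ((1 - p : ℝ) : ℂ) * ((p : ℝ) : ℂ) := by
    have h := congrArg Matrix.det hp
    rw [Matrix.det_mul, Matrix.det_mul, mul_right_comm, hUdet, one_mul, diagonalQubit,
      Matrix.det_diagonal] at h
    rw [h]
    exact Fin.prod_univ_two fun b : ZMod 2 => (bitMass p b : ℂ)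
  rw [hd] at hdet
  have hprod := hdet.trans (Fin.prod_univ_two fun b : ZMod 2 => (hH.eigenvalues b : ℂ))
  have h1 : hH.eigenvalues 0 + hH.eigenvalues 1 = 1 := by exact_mod_cast hsum.symm
  have h2 : (1 - p) * p = hH.eigenvalues 0 * hH.eigenvalues 1 := by exact_mod_cast hprod
  have h3 : (hH.eigenvalues 0 - p) * (hH.eigenvalues 0 - (1 - p)) = 0 := by
    linear_combination h2 + hH.eigenvalues 0 * h1
  rcases mul_eq_zero.1 h3 with h | h
  · left
    constructor <;> linarith
  · right
    constructor <;> linarith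

theorem mem_Icc_of_diagonal {ρ U : Matrix (ZMod 2) (ZMod 2) ℂ} (hρ : IsDensityMatrix ρ)
    (hU : U ∈ Matrix.unitaryGroup (ZMod 2) ℂ) {p : ℝ}
    (hp : U * ρ * U.conjTranspose = diagonalQubit p) : 0 ≤ p ∧ p ≤ 1 := by
  have h0 := hρ.posSemidef.eigenvalues_nonneg 0
  have h1 := hρ.posSemidef.eigenvalues_nonneg 1
  rcases eigenvalues_eq hρ hU hp with ⟨e0, e1⟩ | ⟨e0, e1⟩ <;>
    constructor <;> linarith

theorem vonNeumannEntropy_eq {ρ U : Matrix (ZMod 2) (ZMod 2) ℂ} (hρ : IsDensityMatrix ρ)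
    (hU : U ∈ Matrix.unitaryGroup (ZMod 2) ℂ) {p : ℝ}
    (hp : U * ρ * U.conjTranspose = diagonalQubit p) :
    vonNeumannEntropy hρ.posSemidef.isHermitian = bitEntropy (1 - p) p / Real.log 2 := by
  rw [vonNeumannEntropy, sum_zmod_two, bitEntropy, sub_add_cancel, Real.negMulLog_one, sub_zero]
  rcases eigenvalues_eq hρ hU hp with ⟨e0, e1⟩ | ⟨e0, e1⟩ <;>
    (rw [e0, e1]; simp only [Real.negMulLog, Real.logb]; ring)

theorem prefixMass_level_zero (p : ℝ) (u : Fin (2 ^ 0) → ZMod 2) (i : Fin (2 ^ 0)) (b : ZMod 2) :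
    prefixMass p u i b = bitMass p b := by
  have hsub : Subsingleton (Fin (2 ^ 0)) := inferInstanceAs (Subsingleton (Fin 1))
  rw [prefixMass_eq_sum_ite, Fintype.sum_eq_single fun _ => b]
  · rw [if_pos ⟨fun j hj => absurd (Subsingleton.elim j i) hj.ne, rfl⟩, wordMass,
      Fintype.prod_subsingleton _ i]
    simp [polarTransform]
  · intro w hw
    rw [if_neg]
    rintro ⟨-, h⟩
    exact hw (funext fun j => by rw [Subsingleton.elim j i, h])

theorem levelEntropy_zero_zero (p : ℝ) : levelEntropy p 0 0 = bitEntropy (1 - p) p := by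
  have h : ∀ b : ZMod 2, bitMass p b = if b = 0 then 1 - p else p := fun _ => rfl
  rw [levelEntropy, dif_pos (by norm_num), condEntropy]
  simp only [polarSource, prefixMass_level_zero, bitEntropy_mul, h]
  simp

end SourceState

/-! ### The compression protocol -/

section Protocol

open Filter

/-- Capacity and Bhattacharyya orderings may differ. If a chosen index has large `Z`, pigeonhole
gives an unchosen one with small `Z`, and the chosen index has at most the entropy of that one. -/
theorem condEntropy_le_of_mem {p : ℝ} (h0 : 0 ≤ p) (h1 : p ≤ 1) {ν K : ℕ}
    {A : Finset (Fin (2 ^ ν))} (hA : IsPolarInformationSet p ν K A) {t : ℝ}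
    (hK : K ≤ (Finset.univ.filter fun i : Fin (2 ^ ν) => bhattacharyya (polarSource p i) ≤ t).card)
    {i : Fin (2 ^ ν)} (hi : i ∈ A) : condEntropy (polarSource p i) ≤ 2 * t := by
  have key : ∀ j : Fin (2 ^ ν), bhattacharyya (polarSource p j) ≤ t →
      condEntropy (polarSource p j) ≤ 2 * t := fun j hj =>
    ((isSource_polarSource h0 h1 j).condEntropy_le).trans (by linarith)
  set B := Finset.univ.filter fun i : Fin (2 ^ ν) => bhattacharyya (polarSource p i) ≤ t with hB
  by_cases hiB : i ∈ B
  · exact key i (Finset.mem_filter.1 hiB).2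
  · have : ∃ j ∈ B, j ∉ A := by
      by_contra! hBA
      have hlt : B.card < A.card := Finset.card_lt_card ⟨hBA, fun h => hiB (h hi)⟩
      rw [hA.1] at hlt
      omega
    obtain ⟨j, hjB, hjA⟩ := this
    have hcap := hA.2 i hi j hjA
    rw [capacity_effectiveChannel h0 h1, capacity_effectiveChannel h0 h1, sub_le_sub_iff_left,
      div_le_div_iff_of_pos_right (Real.log_pos (by norm_num))] at hcap
    exact hcap.trans (key j (Finset.mem_filter.1 hjB).2)

theorem card_filter_level (p : ℝ) (n : ℕ) (t : ℝ) :
    ((Finset.range (2 ^ n)).filter fun i => levelBhattacharyya p n i ≤ t).card =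
      (Finset.univ.filter fun i : Fin (2 ^ n) => bhattacharyya (polarSource p i) ≤ t).card := by
  symm
  refine Finset.card_bij (fun i _ => i.1) ?_ (fun i _ j _ h => Fin.ext h) ?_
  · intro i hi
    refine Finset.mem_filter.2 ⟨Finset.mem_range.2 i.2, ?_⟩
    rw [levelBhattacharyya, dif_pos i.2]
    exact (Finset.mem_filter.1 hi).2
  · intro j hj
    obtain ⟨h1, h2⟩ := Finset.mem_filter.1 hj
    rw [levelBhattacharyya, dif_pos (Finset.mem_range.1 h1)] at h2
    exact ⟨⟨j, Finset.mem_range.1 h1⟩, Finset.mem_filter.2 ⟨Finset.mem_univ _, h2⟩, rfl⟩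

theorem tendsto_sum_compl_range {p : ℝ} (h0 : 0 ≤ p) (h1 : p ≤ 1) {H δ : ℝ}
    (hH : H = bitEntropy (1 - p) p / Real.log 2) (hδ : 0 < δ)
    (A : (ν : ℕ) → Finset (Fin (2 ^ ν)))
    (hA : ∀ ν, IsPolarInformationSet p ν ⌊(1 - H - δ) * (2 : ℝ) ^ ν⌋₊ (A ν))
    (f : (ν : ℕ) → ({j : Fin (2 ^ ν) // j ∉ A ν} → ZMod 2) → (Fin (2 ^ ν) → ZMod 2))
    (hf : ∀ ν, IsPolarSyndromeDecoder p (A ν) (f ν)) :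
    Tendsto (fun ν => ∑ x ∈ (Finset.univ.image (f ν))ᶜ, ∏ j, bitMass p (x j)) atTop (nhds 0) := by
  obtain ⟨C, hC⟩ := (isPolarTree_level h0 h1).eventually_le_card hδ
  rw [levelEntropy_zero_zero, ← hH] at hC
  have hlim : Tendsto (fun ν : ℕ => 4 * |C| * (1 / 2 : ℝ) ^ ν) atTop (nhds 0) := by
    simpa using (tendsto_pow_atTop_nhds_zero_of_lt_one (r := (1 / 2 : ℝ)) (by norm_num)
      (by norm_num)).const_mul (4 * |C|)
  refine tendsto_of_tendsto_of_tendsto_of_le_of_le' tendsto_const_nhds hlim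
    (Eventually.of_forall fun ν => Finset.sum_nonneg fun x _ =>
      Finset.prod_nonneg fun j _ => bitMass_nonneg h0 h1 _) (hC.mono fun ν hν => ?_)
  rw [card_filter_level] at hν
  have hK := Nat.floor_le_of_le hν
  refine (sum_compl_range_le h0 h1 (hf ν)).trans ?_
  have hle : ∀ i ∈ A ν, 2 * condEntropy (polarSource p i) ≤ 4 * (|C| * (1 / 4) ^ ν) := fun i hi => by
    have hCle : C * (1 / 4) ^ ν ≤ |C| * (1 / 4) ^ ν :=
      mul_le_mul_of_nonneg_right (le_abs_self C) (by positivity)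
    linarith [condEntropy_le_of_mem h0 h1 (hA ν) hK hi]
  refine (Finset.sum_le_card_nsmul _ _ _ hle).trans ?_
  rw [nsmul_eq_mul]
  have hcard : ((A ν).card : ℝ) ≤ 2 ^ ν := by
    have := Finset.card_le_univ (A ν)
    rw [Fintype.card_fin] at this
    exact_mod_cast this
  calc _ ≤ (2 : ℝ) ^ ν * (4 * (|C| * (1 / 4) ^ ν)) :=
        mul_le_mul_of_nonneg_right hcard (by positivity)
    _ = 4 * |C| * (2 * (1 / 4)) ^ ν := by rw [mul_pow]; ring
    _ = _ := by norm_num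

theorem card_compl_le {x : ℝ} {ν : ℕ} {A : Finset (Fin (2 ^ ν))}
    (hA : A.card = ⌊(1 - x) * (2 : ℝ) ^ ν⌋₊) : Aᶜ.card ≤ ⌈(2 : ℝ) ^ ν * x⌉₊ := by
  rw [Finset.card_compl, Fintype.card_fin, hA, Nat.sub_le_iff_le_add]
  have h1 := Nat.lt_floor_add_one ((1 - x) * (2 : ℝ) ^ ν)
  have h2 := Nat.le_ceil ((2 : ℝ) ^ ν * x)
  have h3 : (2 : ℝ) ^ ν < ⌈(2 : ℝ) ^ ν * x⌉₊ + ⌊(1 - x) * (2 : ℝ) ^ ν⌋₊ + 1 := by linarith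
  exact Nat.lt_succ_iff.1 (by exact_mod_cast h3)

theorem tendsto_card_compl_div {x : ℝ} (A : (ν : ℕ) → Finset (Fin (2 ^ ν)))
    (hA : ∀ ν, (A ν).card = ⌊(1 - x) * (2 : ℝ) ^ ν⌋₊) :
    Tendsto (fun ν => ((A ν)ᶜ.card : ℝ) / (2 : ℝ) ^ ν) atTop (nhds (min x 1)) := by
  have hcard : ∀ ν, ((A ν)ᶜ.card : ℝ) / (2 : ℝ) ^ ν =
      1 - (⌊(1 - x) * (2 : ℝ) ^ ν⌋₊ : ℝ) / (2 : ℝ) ^ ν := by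
    intro ν
    have hle := Finset.card_le_univ (A ν)
    rw [Finset.card_compl, Nat.cast_sub hle, Fintype.card_fin, hA, sub_div]
    push_cast
    rw [div_self (by positivity)]
  simp only [hcard]
  rcases le_total x 1 with hx | hx
  · rw [min_eq_left hx, show x = 1 - (1 - x) by ring]
    refine tendsto_const_nhds.sub ?_
    have h := (tendsto_nat_floor_mul_div_atTop (R := ℝ) (a := 1 - x) (by linarith)).comp
      (tendsto_pow_atTop_atTop_of_one_lt (r := (2 : ℝ)) (by norm_num))
    simpa [Function.comp_def] using h
  -- The natural floor truncates at zero: every index is frozen.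
  · have hz : ∀ ν : ℕ, ⌊(1 - x) * (2 : ℝ) ^ ν⌋₊ = 0 := fun ν =>
      Nat.floor_of_nonpos (mul_nonpos_of_nonpos_of_nonneg (by linarith) (by positivity))
    simp [hz, min_eq_right hx]

end Protocol

theorem proposition2
    (ρ : Matrix (ZMod 2) (ZMod 2) ℂ) (hρ : IsDensityMatrix ρ)
    (U : Matrix (ZMod 2) (ZMod 2) ℂ) (hU : U ∈ Matrix.unitaryGroup (ZMod 2) ℂ)
    (p : ℝ) (hp : U * ρ * U.conjTranspose = diagonalQubit p)
    (H : ℝ) (hH : H = vonNeumannEntropy hρ.posSemidef.isHermitian)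
    (δ : ℝ) (hδ : 0 < δ)
    (A : (ν : ℕ) → Finset (Fin (2 ^ ν)))
    (hA : ∀ ν, IsPolarInformationSet p ν ⌊(1 - H - δ) * (2 : ℝ) ^ ν⌋₊ (A ν))
    (f : (ν : ℕ) → ({j : Fin (2 ^ ν) // j ∉ A ν} → ZMod 2) → (Fin (2 ^ ν) → ZMod 2))
    (hf : ∀ ν, IsPolarSyndromeDecoder p (A ν) (f ν)) :
    Filter.Tendsto (fun ν => failureProbability ρ U (f ν)) Filter.atTop (nhds 0) ∧
    (∀ ν, (A ν)ᶜ.card ≤ ⌈(2 : ℝ) ^ ν * (H + δ)⌉₊) ∧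
    Filter.Tendsto (fun ν => ((A ν)ᶜ.card : ℝ) / (2 : ℝ) ^ ν) Filter.atTop
      (nhds (min (H + δ) 1)) := by
  obtain ⟨h0, h1⟩ := mem_Icc_of_diagonal hρ hU hp
  have hcard : ∀ ν, (A ν).card = ⌊(1 - (H + δ)) * (2 : ℝ) ^ ν⌋₊ := fun ν => by
    rw [(hA ν).1, sub_sub]
  refine ⟨?_, fun ν => card_compl_le (hcard ν), tendsto_card_compl_div A hcard⟩
  have h := tendsto_sum_compl_range h0 h1 (hH.trans (vonNeumannEntropy_eq hρ hU hp)) hδ A hA f hf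
  simp only [failureProbability_eq hp]
  exact (Complex.continuous_ofReal.tendsto' 0 0 Complex.ofReal_zero).comp h
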